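/- Let $j_A\in\{\tfrac12,1,\tfrac32,\dots\}$ and $j_B\in\{0,\tfrac12,1,\dots\}$, let $\mathcal H_A,\mathcal H_B$ be the Hilbert spaces of a spin-$j_A$ and a spin-$j_B$ system, of dimensions $d_A=2j_A+1$ and $d_B=2j_B+1$, with spin operators $J_A^k,J_B^k$ ($k=x,y,z$) and SU(2)-irreps $U_A(g)=e^{i\sum_k g_kJ_A^k}$, $U_B(g)=e^{i\sum_k g_kJ_B^k}$, $g\in\mathbb R^3$. A channel is a completely positive trace-preserving linear map $\mathcal E:\mathcal B(\mathcal H_A)\to\mathcal B(\mathcal H_B)$; it is SU(2)-covariant if $\mathcal E(U_A(g)XU_A(g)^\dagger)=U_B(g)\mathcal E(X)U_B(g)^\dagger$ for all $g$ and $X$. The polarisation vector of a state $\rho$ is $\mathbf P(\rho)=(\mathrm{tr}(J^k\rho))_{k=x,y,z}$, and $\mathcal E$ scales the polarisation by $\kappa\in\mathbb R$ if $\mathbf P(\mathcal E(\rho))=\kappa\,\mathbf P(\rho)$ for all states $\rho$ on $\mathcal H_A$. For $L\in\{|j_A-j_B|,\dots,j_A+j_B\}$ let $\mathcal E^{(L)}$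 be the linear map whose Jamio\l kowski operator $\frac1{d_A}\sum_{p,q}\mathcal E^{(L)}(|p\rangle\langle q|)\otimes|p\rangle\langle q|$, with $|p\rangle$ running over the basis of $J_A^z$-eigenvectors $|j_A,m\rangle$ with the standard phases, is $\mathbb 1^L/(2L+1)$, where $\mathbb 1^L$ is the orthogonal projection onto the subspace of $\mathcal H_B\otimes\mathcal H_A$ of total angular momentum $L$ for the representation $U_B\otimes U_A^*$. Then every SU(2)-covariant channel scales the polarisation by exactly one real factor $\kappa$. The map $\mathcal E^{(|j_A-j_B|)}$ is an SU(2)-covariant channel, is an extreme point of the convex set of SU(2)-covariant channels, and scales the polarisation by $$\kappa_+=\begin{cases} j_B/j_A, & j_A\ge j_B,\\[2pt] (j_B+1)/(j_A+1), & j_A<j_B.\end{cases}$$ Moreover $\kappa_+$ is the largest factor by which an SU(2)-covariant channel $\mathcal B(\mathcal H_A)\to\mathcal B(\mathcal H_B)$ scales the polarisation, and also the largest factor over all channels (covariant or not) that scale the polarisation of every state by a common real factor. -/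

import Mathlib

open scoped Kronecker ComplexOrder

namespace SpinChannel

noncomputable section

/-- The operators on the Hilbert space of a spin-`n/2` system, written as matrices in the standard
basis `|j, j⟩, |j, j - 1⟩, …, |j, -j⟩`, where `j = n/2`. -/
abbrev Op (n : ℕ) : Type := Matrix (Fin (n + 1)) (Fin (n + 1)) ℂ

/-- The spin `j = n/2`. -/
def spin (n : ℕ) : ℝ := (n : ℝ) / 2

/-- The magnetic quantum number `m = j - i` of the `i`-th basis vector. -/
def magnetic (n : ℕ) (i : Fin (n + 1)) : ℝ := spin n - (i : ℝ)

/-- The raising operator, `J₊ |j, m⟩ = √(j (j + 1) - m (m + 1)) |j, m + 1⟩`. -/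
def spinRaise (n : ℕ) : Op n := Matrix.of fun i k =>
  if (i : ℕ) + 1 = (k : ℕ) then
    ((Real.sqrt (spin n * (spin n + 1) - magnetic n k * (magnetic n k + 1)) : ℝ) : ℂ)
  else 0

/-- The spin operators `(J^x, J^y, J^z)`, indexed by `0, 1, 2`. -/
def spinOp (n : ℕ) : Fin 3 → Op n :=
  ![(1 / 2 : ℂ) • (spinRaise n + (spinRaise n).conjTranspose),
    (-Complex.I / 2) • (spinRaise n - (spinRaise n).conjTranspose),
    Matrix.diagonal fun i => ((magnetic n i : ℝ) : ℂ)]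

/-- The rotation `U(g) = exp (i J · g)`. As `g` runs through `ℝ³`, these are exactly the operators
of the spin-`n/2` irreducible representation of SU(2): `U(g)` represents `exp (i σ · g / 2)`. -/
def rotation (n : ℕ) (g : Fin 3 → ℝ) : Op n :=
  NormedSpace.exp (Complex.I • ∑ k, ((g k : ℝ) : ℂ) • spinOp n k)

/-- The map `Φ ⊗ id` on operators on `H_A ⊗ ℂ^k`. -/
def ampliation {a b : ℕ} (Φ : Op a →ₗ[ℂ] Op b) (k : ℕ)
    (M : Matrix (Fin (a + 1) × Fin k) (Fin (a + 1) × Fin k) ℂ) :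
    Matrix (Fin (b + 1) × Fin k) (Fin (b + 1) × Fin k) ℂ :=
  Matrix.of fun p q => Φ (Matrix.of fun i j => M (i, p.2) (j, q.2)) p.1 q.1

/-- A quantum channel: a completely positive, trace-preserving linear map. -/
structure IsChannel {a b : ℕ} (Φ : Op a →ₗ[ℂ] Op b) : Prop where
  completelyPositive : ∀ (k : ℕ) (M : Matrix (Fin (a + 1) × Fin k) (Fin (a + 1) × Fin k) ℂ),
    M.PosSemidef → (ampliation Φ k M).PosSemidef
  tracePreserving : ∀ X : Op a, (Φ X).trace = X.trace

/-- SU(2)-covariance. -/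
def IsCovariant {a b : ℕ} (Φ : Op a →ₗ[ℂ] Op b) : Prop :=
  ∀ (g : Fin 3 → ℝ) (X : Op a),
    Φ (rotation a g * X * (rotation a g).conjTranspose) =
      rotation b g * Φ X * (rotation b g).conjTranspose

/-- The set of SU(2)-covariant channels from a spin-`a/2` to a spin-`b/2` system. -/
def covariantChannels (a b : ℕ) : Set (Op a →ₗ[ℂ] Op b) :=
  {Φ | IsChannel Φ ∧ IsCovariant Φ}

/-- Density operators. -/
def IsState {n : ℕ} (ρ : Op n) : Prop := ρ.PosSemidef ∧ ρ.trace = 1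

/-- The spin polarisation vector `P_k(ρ) = tr (J^k ρ)`. -/
def polarisation {n : ℕ} (ρ : Op n) (k : Fin 3) : ℂ := (spinOp n k * ρ).trace

/-- `Φ` scales the polarisation of every state by the real factor `κ`. -/
def ScalesPolarisation {a b : ℕ} (Φ : Op a →ₗ[ℂ] Op b) (κ : ℝ) : Prop :=
  ∀ ρ : Op a, IsState ρ → ∀ k : Fin 3, polarisation (Φ ρ) k = (κ : ℂ) * polarisation ρ k

/-- Generators of the representation `U_B(g) ⊗ U_A(g)^*` on `H_B ⊗ H_A`. Since `J^k` is Hermitian,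
its entrywise complex conjugate is its transpose. -/
def totalSpinOp (a b : ℕ) (k : Fin 3) :
    Matrix (Fin (b + 1) × Fin (a + 1)) (Fin (b + 1) × Fin (a + 1)) ℂ :=
  spinOp b k ⊗ₖ (1 : Op a) - (1 : Op b) ⊗ₖ (spinOp a k).transpose

/-- The subspace of `H_B ⊗ H_A` of total angular momentum `L` for the representation
`U_B ⊗ U_A^*`: the eigenspace of the squared total angular momentum for `L (L + 1)`. For
`L = |j_A - j_B|, …, j_A + j_B` it carries the spin-`L` irreducible representation, which occurs
exactly once. -/
def totalSpinSubspace (a b : ℕ) (L : ℝ) :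
    Submodule ℂ (EuclideanSpace ℂ (Fin (b + 1) × Fin (a + 1))) :=
  Module.End.eigenspace
    (Matrix.toEuclideanLin (∑ k, totalSpinOp a b k * totalSpinOp a b k))
    ((L * (L + 1) : ℝ) : ℂ)

/-- The matrix of the orthogonal projection onto the subspace of total angular momentum `L`. -/
def totalSpinProjection (a b : ℕ) (L : ℝ) :
    Matrix (Fin (b + 1) × Fin (a + 1)) (Fin (b + 1) × Fin (a + 1)) ℂ :=
  Matrix.toEuclideanLin.symm (totalSpinSubspace a b L).starProjection.toLinearMap

/-- The linear map with Jamiołkowski operator `𝒥 = d_A⁻¹ ∑_{p,q} Φ(|p⟩⟨q|) ⊗ |p⟩⟨q|`, i.e.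
`Φ(X) = d_A tr_A (𝒥 (1 ⊗ Xᵀ))`, in coordinates. -/
def ofJamiolkowski {a b : ℕ}
    (𝒥 : Matrix (Fin (b + 1) × Fin (a + 1)) (Fin (b + 1) × Fin (a + 1)) ℂ) :
    Op a →ₗ[ℂ] Op b where
  toFun X := Matrix.of fun i j => ((a : ℂ) + 1) * ∑ p, ∑ q, 𝒥 (i, p) (j, q) * X p q
  map_add' X Y := by
    ext i j
    simp [mul_add, Finset.sum_add_distrib]
  map_smul' c X := by
    ext i j
    simp only [Matrix.of_apply, Matrix.smul_apply, smul_eq_mul, RingHom.id_apply, Finset.mul_sum]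
    refine Finset.sum_congr rfl fun p _ => Finset.sum_congr rfl fun q _ => ?_
    ring

/-- The channel `ℰ^{(L)}`, whose Jamiołkowski state is the normalised projection `1^L / (2 L + 1)`
onto the spin-`L` subspace of `H_B ⊗ H_A`. -/
def extremalChannel (a b : ℕ) (L : ℝ) : Op a →ₗ[ℂ] Op b :=
  ofJamiolkowski (((2 * L + 1 : ℝ) : ℂ)⁻¹ • totalSpinProjection a b L)

/-- The amplification factor `κ₊` in terms of the input spin `jA` and the output spin `jB`. -/
def amplificationFactor (jA jB : ℝ) : ℝ :=
  if jB ≤ jA then jB / jA else (jB + 1) / (jA + 1)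

end

end SpinChannel

namespace SpinChannel

/-! Represent a map Φ by its Choi matrix on H_B ⊗ H_A, and let C be the squared total angular
momentum for U_B ⊗ U_A^*. The generators of U_A^* are -(J_A^k)ᵀ, so C = j_B(j_B+1) + j_A(j_A+1) - 2
∑ J_B^k ⊗ (J_A^k)ᵀ, and the trace of the coupling term against the Choi matrix is ∑ tr(J_B^k
Φ(J_A^k)). If Φ scales the polarisation by κ, this sum equals κ j_A(j_A+1) d_A. Hence κ is a
decreasing affine function of the mean of C in the Jamiołkowski state (`trace_casimir_mul_choi`).

Put M = |j_A - j_B|. Every eigenspace of C is invariant and contains a highest-weight vector, whose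
weight is at least M; therefore C ≥ M(M+1) (`casimir_sub_posSemidef`). This bounds κ by the value at
equality, which is κ₊ (`amplificationFactor_mul`). Covariance plays no role in the bound, so it
serves both maxima. The projection channel attains it because its Choi matrix lives in the bottom
eigenspace.

Covariance is used through the Lie algebra, where it says that the Choi matrix commutes with the
total spin. The Heisenberg adjoint then sends J_B to a vector operator on H_A, which is a multiple
of J_A (`dual_spinOp`); hermiticity makes the factor real. For the projection channel, trace
preservation follows from Schur's lemma and the dimension 2M+1 of the bottom subspace, found by
counting weights (`trace_projection`). Extremality rests on irreducibility of that subspace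
(`eq_smul_projection_of_commute`). -/

open Matrix

/-! ### Spin matrices of a single system. -/

/-- The squared matrix element of the raising operator in column `k`. -/
noncomputable def ladder (n k : ℕ) : ℝ := (k : ℝ) * ((n : ℝ) + 1 - k)

lemma ladder_pos {n k : ℕ} (hk : 0 < k) (hkn : k ≤ n) : 0 < ladder n k := by
  have h1 : (0 : ℝ) < k := by exact_mod_cast hk
  have h2 : (k : ℝ) ≤ n := by exact_mod_cast hkn
  exact mul_pos h1 (by linarith)

lemma ladder_nonneg {n k : ℕ} (hkn : k ≤ n) : 0 ≤ ladder n k := by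
  have h2 : (k : ℝ) ≤ n := by exact_mod_cast hkn
  exact mul_nonneg (Nat.cast_nonneg k) (by linarith)

lemma spinRaise_apply (n : ℕ) (i k : Fin (n + 1)) :
    spinRaise n i k = if (i : ℕ) + 1 = k then ((√(ladder n k) : ℝ) : ℂ) else 0 := by
  have : spin n * (spin n + 1) - magnetic n k * (magnetic n k + 1) = ladder n k := by
    simp only [magnetic, spin, ladder]; ring
  simp [spinRaise, this]

lemma spinRaise_ne_zero {n : ℕ} {i k : Fin (n + 1)} (h : (i : ℕ) + 1 = k) :
    spinRaise n i k ≠ 0 := by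
  rw [spinRaise_apply, if_pos h]
  exact_mod_cast (Real.sqrt_pos.2 (ladder_pos (by omega) (by omega))).ne'

lemma spinRaise_eq_zero {n : ℕ} {i k : Fin (n + 1)} (h : (i : ℕ) + 1 ≠ k) :
    spinRaise n i k = 0 := by
  rw [spinRaise_apply, if_neg h]

lemma star_spinRaise (n : ℕ) (i k : Fin (n + 1)) : star (spinRaise n i k) = spinRaise n i k := by
  rw [spinRaise_apply]; split_ifs <;> simp

lemma sqrt_ladder_sq {n k : ℕ} (hkn : k ≤ n) :
    ((√(ladder n k) : ℝ) : ℂ) * ((√(ladder n k) : ℝ) : ℂ) = (ladder n k : ℂ) := by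
  rw [← Complex.ofReal_mul, Real.mul_self_sqrt (ladder_nonneg hkn)]

lemma spinRaise_mul_conjTranspose (n : ℕ) :
    spinRaise n * (spinRaise n)ᴴ = diagonal fun i : Fin (n + 1) => (ladder n (i + 1) : ℂ) := by
  ext i k
  simp only [mul_apply, conjTranspose_apply, star_spinRaise, diagonal_apply]
  by_cases hi : (i : ℕ) + 1 ≤ n
  · rw [Finset.sum_eq_single (⟨i + 1, by omega⟩ : Fin (n + 1))]
    · rw [spinRaise_apply, spinRaise_apply]
      by_cases hik : i = k
      · subst hik; simp only [if_true, sqrt_ladder_sq hi]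
      · rw [if_neg hik, if_neg (c := (k : ℕ) + 1 = _), mul_zero]
        simp only [Nat.add_right_cancel_iff]
        exact fun h => hik (Fin.ext h.symm)
    · intro x _ hx
      rw [spinRaise_eq_zero, zero_mul]
      exact fun h => hx (Fin.ext h.symm)
    · simp
  -- The last row of J₊ vanishes, in agreement with `ladder n (n + 1) = 0`.
  · rw [Finset.sum_eq_zero]
    · have : (i : ℕ) = n := by omega
      split_ifs <;> simp [ladder, this]
    · intro x _
      rw [spinRaise_eq_zero, zero_mul]
      omega

lemma conjTranspose_mul_spinRaise (n : ℕ) :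
    (spinRaise n)ᴴ * spinRaise n = diagonal fun i : Fin (n + 1) => (ladder n i : ℂ) := by
  ext i k
  simp only [mul_apply, conjTranspose_apply, star_spinRaise, diagonal_apply]
  by_cases hi : 0 < (i : ℕ)
  · rw [Finset.sum_eq_single (⟨i - 1, by omega⟩ : Fin (n + 1))]
    · rw [spinRaise_apply, spinRaise_apply]
      by_cases hik : i = k
      · subst hik
        rw [if_pos (by simp only []; omega), if_pos rfl, sqrt_ladder_sq (by omega)]
      · rw [if_neg hik, if_neg (c := _ = (k : ℕ)), mul_zero]
        simp only []
        exact fun h => hik (Fin.ext (by omega))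
    · intro x _ hx
      rw [spinRaise_eq_zero, zero_mul]
      exact fun h => hx (Fin.ext (by simp only []; omega))
    · simp
  · rw [Finset.sum_eq_zero]
    · have : (i : ℕ) = 0 := by omega
      split_ifs <;> simp [ladder, this]
    · intro x _
      rw [spinRaise_eq_zero, zero_mul]
      omega

lemma spinOp_zero (n : ℕ) :
    spinOp n 0 = (1 / 2 : ℂ) • (spinRaise n + (spinRaise n)ᴴ) := rfl

lemma spinOp_one (n : ℕ) :
    spinOp n 1 = (-Complex.I / 2) • (spinRaise n - (spinRaise n)ᴴ) := rfl

lemma spinOp_two (n : ℕ) :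
    spinOp n 2 = diagonal fun i => ((magnetic n i : ℝ) : ℂ) := rfl

lemma spinOp_isHermitian (n : ℕ) (k : Fin 3) : (spinOp n k).IsHermitian := by
  fin_cases k
  · change (spinOp n 0)ᴴ = spinOp n 0
    rw [spinOp_zero, conjTranspose_smul, conjTranspose_add, conjTranspose_conjTranspose, add_comm (spinRaise n)ᴴ]
    simp
  · change (spinOp n 1)ᴴ = spinOp n 1
    rw [spinOp_one, conjTranspose_smul, conjTranspose_sub, conjTranspose_conjTranspose,
      ← neg_sub (spinRaise n), smul_neg, ← neg_smul]
    congr 1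
    simp [neg_div]
  · change (spinOp n 2)ᴴ = spinOp n 2
    rw [spinOp_two, diagonal_conjTranspose]
    congr 1
    ext i
    simp

/-- `[J₊, J₋] = 2 J_z`. -/
lemma spinRaise_commutator (n : ℕ) :
    spinRaise n * (spinRaise n)ᴴ - (spinRaise n)ᴴ * spinRaise n = (2 : ℂ) • spinOp n 2 := by
  rw [spinRaise_mul_conjTranspose, conjTranspose_mul_spinRaise, spinOp_two, diagonal_sub,
    ← diagonal_smul]
  congr 1
  ext i
  simp only [ladder, magnetic, spin, Pi.smul_apply, smul_eq_mul]
  push_cast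
  ring

/-- `[J_z, J₊] = J₊`. -/
lemma spinOp_two_commutator (n : ℕ) :
    spinOp n 2 * spinRaise n - spinRaise n * spinOp n 2 = spinRaise n := by
  ext i k
  rw [spinOp_two, Matrix.sub_apply, diagonal_mul, mul_diagonal]
  by_cases h : (i : ℕ) + 1 = k
  · have : (k : ℂ) = (i : ℂ) + 1 := by rw [← Nat.cast_succ, ← h]
    simp only [magnetic]
    push_cast
    rw [this]
    ring
  · simp [spinRaise_eq_zero h]

/-- The squared angular momentum is `j (j + 1)`. -/
lemma sum_spinOp_sq (n : ℕ) :
    ∑ k, spinOp n k * spinOp n k = ((spin n * (spin n + 1) : ℝ) : ℂ) • (1 : Op n) := by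
  have key : ∑ k, spinOp n k * spinOp n k = (1 / 2 : ℂ) • (spinRaise n * (spinRaise n)ᴴ +
      (spinRaise n)ᴴ * spinRaise n) + spinOp n 2 * spinOp n 2 := by
    rw [Fin.sum_univ_three, spinOp_zero, spinOp_one]
    simp only [smul_mul_smul_comm, add_mul, mul_add, sub_mul, mul_sub]
    have : -Complex.I / 2 * (-Complex.I / 2) = -(1 / 4) := by
      linear_combination (1 / 4 : ℂ) * Complex.I_mul_I
    rw [this]
    module
  rw [key, spinRaise_mul_conjTranspose, conjTranspose_mul_spinRaise, spinOp_two, diagonal_add,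
    diagonal_mul_diagonal, ← diagonal_smul, diagonal_add, smul_one_eq_diagonal]
  congr 1
  ext i
  simp only [ladder, magnetic, spin, Pi.smul_apply, smul_eq_mul]
  push_cast
  ring

/-- Schur's lemma for the spin-`n/2` representation. -/
lemma eq_smul_one_of_commute {n : ℕ} {X : Op n} (hz : Commute (spinOp n 2) X)
    (hp : Commute (spinRaise n) X) : X = X 0 0 • (1 : Op n) := by
  have hoff : ∀ i k, i ≠ k → X i k = 0 := by
    intro i k hik
    have h := congrFun (congrFun hz.eq i) k
    rw [spinOp_two, diagonal_mul, mul_diagonal] at h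
    have h2 : ((magnetic n i : ℂ) - magnetic n k) * X i k = 0 := by linear_combination h
    rcases mul_eq_zero.1 h2 with h3 | h3
    · exfalso
      apply hik
      simp only [magnetic] at h3
      push_cast at h3
      have h4 : ((i : ℕ) : ℂ) = (k : ℕ) := by linear_combination -h3
      exact Fin.ext (by exact_mod_cast h4)
    · exact h3
  -- The nonzero superdiagonal entries of J₊ force consecutive diagonal entries of `X` to agree.
  have hdiag : ∀ (m : ℕ) (hm : m < n + 1), X ⟨m, hm⟩ ⟨m, hm⟩ = X 0 0 := by
    intro m
    induction m with
    | zero => intro _; rfl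
    | succ m ih =>
      intro hm
      rw [← ih (by omega)]
      have h := congrFun (congrFun hp.eq ⟨m, by omega⟩) ⟨m + 1, hm⟩
      rw [mul_apply, mul_apply, Finset.sum_eq_single (⟨m + 1, hm⟩ : Fin (n + 1)),
        Finset.sum_eq_single (⟨m, by omega⟩ : Fin (n + 1)), mul_comm] at h
      · exact mul_right_cancel₀ (spinRaise_ne_zero rfl) h
      · intro x _ hx; rw [hoff _ _ hx.symm, zero_mul]
      · simp
      · intro x _ hx; rw [hoff _ _ hx, mul_zero]
      · simp
  ext i k
  by_cases h : i = k
  · subst h; simp [hdiag i i.2]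
  · simp [hoff i k h, one_apply_ne h]

/-- An operator that transforms like the highest component of a vector operator is proportional
to the raising operator. -/
lemma eq_smul_spinRaise {n : ℕ} (hn : 0 < n) {X : Op n}
    (hz : spinOp n 2 * X - X * spinOp n 2 = X) (hp : Commute (spinRaise n) X) :
    ∃ κ : ℂ, X = κ • spinRaise n := by
  have hoff : ∀ i k : Fin (n + 1), (i : ℕ) + 1 ≠ k → X i k = 0 := by
    intro i k hik
    have h := congrFun (congrFun hz i) k
    rw [spinOp_two, Matrix.sub_apply, diagonal_mul, mul_diagonal] at h
    have h2 : ((magnetic n i : ℂ) - magnetic n k - 1) * X i k = 0 := by linear_combination h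
    rcases mul_eq_zero.1 h2 with h3 | h3
    · exfalso
      apply hik
      simp only [magnetic] at h3
      push_cast at h3
      have h4 : ((i : ℕ) : ℂ) + 1 = (k : ℕ) := by linear_combination -h3
      exact_mod_cast h4
    · exact h3
  -- The simplest case of Wigner–Eckart: weight one confines `X` to the superdiagonal, and commuting
  -- with J₊ propagates the ratio of the first entries along it.
  refine ⟨X ⟨0, by omega⟩ ⟨1, by omega⟩ / spinRaise n ⟨0, by omega⟩ ⟨1, by omega⟩, ?_⟩
  set κ := X ⟨0, by omega⟩ ⟨1, by omega⟩ / spinRaise n ⟨0, by omega⟩ ⟨1, by omega⟩ with hκ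
  have hsup : ∀ (m : ℕ) (hm : m + 1 < n + 1),
      X ⟨m, by omega⟩ ⟨m + 1, hm⟩ = κ * spinRaise n ⟨m, by omega⟩ ⟨m + 1, hm⟩ := by
    intro m
    induction m with
    | zero =>
      intro hm
      rw [hκ]
      exact (div_mul_cancel₀ _ (spinRaise_ne_zero rfl)).symm
    | succ m ih =>
      intro hm
      have h := congrFun (congrFun hp.eq ⟨m, by omega⟩) ⟨m + 2, hm⟩
      rw [mul_apply, mul_apply, Finset.sum_eq_single (⟨m + 1, by omega⟩ : Fin (n + 1)),
        Finset.sum_eq_single (⟨m + 1, by omega⟩ : Fin (n + 1)), ih (by omega)] at h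
      · have h0 : spinRaise n ⟨m, by omega⟩ ⟨m + 1, by omega⟩ ≠ 0 := spinRaise_ne_zero rfl
        refine mul_left_cancel₀ h0 ?_
        rw [h]
        ring
      · intro x _ hx
        rw [hoff, zero_mul]
        exact fun h => hx (Fin.ext h.symm)
      · simp
      · intro x _ hx
        rw [spinRaise_eq_zero, zero_mul]
        exact fun h => hx (Fin.ext h.symm)
      · simp
  ext i k
  by_cases h : (i : ℕ) + 1 = k
  · have hk : k = ⟨i + 1, by omega⟩ := Fin.ext h.symm
    rw [hk, Matrix.smul_apply, smul_eq_mul]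
    exact hsup i (by omega)
  · rw [hoff i k h, Matrix.smul_apply, spinRaise_eq_zero h, smul_zero]

/-! ### Total angular momentum and its Casimir operator. -/

section LadderAlgebra

variable {R : Type*} [Ring R] {x y h : R}

/-- The element is the Casimir in normal order. Only the relations of a ladder triple enter, so no
matrix entries are needed. -/
lemma commute_casimir_raise (hx : h * x - x * h = x) (hxy : x * y - y * x = h + h) :
    Commute (y * x + h * h + h) x := by
  change _ * _ = _ * _
  linear_combination (norm := noncomm_ring) -(hxy * x) + h * hx + hx * h

lemma commute_casimir_weight (hx : h * x - x * h = x) (hy : h * y - y * h = -y) :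
    Commute (y * x + h * h + h) h := by
  change _ * _ = _ * _
  linear_combination (norm := noncomm_ring) -(y * hx) - hy * x

end LadderAlgebra

/-- Generators of `U_B ⊗ U_A^*` for complex combinations of the spin operators. -/
noncomputable def tensorGenerator {a b : ℕ} (Y : Op b) (X : Op a) :
    Matrix (Fin (b + 1) × Fin (a + 1)) (Fin (b + 1) × Fin (a + 1)) ℂ :=
  Y ⊗ₖ (1 : Op a) - (1 : Op b) ⊗ₖ Xᵀ

section TensorGenerator

variable {a b : ℕ}

lemma tensorGenerator_add (Y Y' : Op b) (X X' : Op a) :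
    tensorGenerator (Y + Y') (X + X') = tensorGenerator Y X + tensorGenerator Y' X' := by
  simp only [tensorGenerator, add_kronecker, transpose_add, kronecker_add]
  abel

lemma tensorGenerator_smul (c : ℂ) (Y : Op b) (X : Op a) :
    tensorGenerator (c • Y) (c • X) = c • tensorGenerator Y X := by
  simp only [tensorGenerator, smul_kronecker, transpose_smul, kronecker_smul, smul_sub]

lemma tensorGenerator_sub (Y Y' : Op b) (X X' : Op a) :
    tensorGenerator (Y - Y') (X - X') = tensorGenerator Y X - tensorGenerator Y' X' := by
  have h := tensorGenerator_add Y ((-1 : ℂ) • Y') X ((-1 : ℂ) • X')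
  rw [tensorGenerator_smul] at h
  simpa [sub_eq_add_neg] using h

lemma tensorGenerator_conjTranspose (Y : Op b) (X : Op a) :
    (tensorGenerator Y X)ᴴ = tensorGenerator Yᴴ Xᴴ := by
  simp only [tensorGenerator, conjTranspose_sub, conjTranspose_kronecker, conjTranspose_one]
  rfl

/-- The map `X ↦ -Xᵀ` respects commutators because transposition reverses products, and operators on
different tensor factors commute. -/
lemma tensorGenerator_commutator (Y Y' : Op b) (X X' : Op a) :
    tensorGenerator Y X * tensorGenerator Y' X' - tensorGenerator Y' X' * tensorGenerator Y X =
      tensorGenerator (Y * Y' - Y' * Y) (X * X' - X' * X) := by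
  rw [tensorGenerator_sub]
  simp only [tensorGenerator, mul_sub, sub_mul, ← mul_kronecker_mul, mul_one, one_mul,
    transpose_mul]
  abel

lemma tensorGenerator_mulVec_apply (Y : Op b) (X : Op a) (w : Fin (b + 1) × Fin (a + 1) → ℂ)
    (i : Fin (b + 1)) (p : Fin (a + 1)) :
    (tensorGenerator Y X *ᵥ w) (i, p) = ∑ i', Y i i' * w (i', p) - ∑ p', X p' p * w (i, p') := by
  rw [tensorGenerator, sub_mulVec, Pi.sub_apply]
  congr 1
  · simp [mulVec, dotProduct, Fintype.sum_prod_type, one_apply]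
  · simp [mulVec, dotProduct, Fintype.sum_prod_type, one_apply]

end TensorGenerator

lemma totalSpinOp_eq (a b : ℕ) (k : Fin 3) :
    totalSpinOp a b k = tensorGenerator (spinOp b k) (spinOp a k) := rfl

/-- The raising operator of the total angular momentum. -/
noncomputable def totalRaise (a b : ℕ) :
    Matrix (Fin (b + 1) × Fin (a + 1)) (Fin (b + 1) × Fin (a + 1)) ℂ :=
  tensorGenerator (spinRaise b) (spinRaise a)

/-- The total magnetic quantum number of a product basis vector. -/
noncomputable def weight (a b : ℕ) (x : Fin (b + 1) × Fin (a + 1)) : ℝ :=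
  magnetic b x.1 - magnetic a x.2

/-- The squared total angular momentum. -/
noncomputable def casimir (a b : ℕ) :
    Matrix (Fin (b + 1) × Fin (a + 1)) (Fin (b + 1) × Fin (a + 1)) ℂ :=
  ∑ k, totalSpinOp a b k * totalSpinOp a b k

section Total

variable (a b : ℕ)

lemma totalSpinOp_zero :
    totalSpinOp a b 0 = (1 / 2 : ℂ) • (totalRaise a b + (totalRaise a b)ᴴ) := by
  rw [totalSpinOp_eq, spinOp_zero, spinOp_zero, tensorGenerator_smul, tensorGenerator_add,
    totalRaise, tensorGenerator_conjTranspose]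

lemma totalSpinOp_one :
    totalSpinOp a b 1 = (-Complex.I / 2) • (totalRaise a b - (totalRaise a b)ᴴ) := by
  rw [totalSpinOp_eq, spinOp_one, spinOp_one, tensorGenerator_smul, tensorGenerator_sub,
    totalRaise, tensorGenerator_conjTranspose]

lemma totalSpinOp_two :
    totalSpinOp a b 2 = diagonal fun x => ((weight a b x : ℝ) : ℂ) := by
  ext ⟨i, p⟩ ⟨j, q⟩
  simp only [totalSpinOp, spinOp_two, Matrix.sub_apply, kroneckerMap_apply, diagonal_apply,
    one_apply, transpose_apply, Prod.mk.injEq, weight]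
  by_cases h : i = j <;> by_cases h' : p = q
  · subst h h'; simp
  · simp [h, h', Ne.symm h']
  · simp [h, h']
  · simp [h, h', Ne.symm h']

lemma totalSpinOp_isHermitian (k : Fin 3) : (totalSpinOp a b k).IsHermitian := by
  change (totalSpinOp a b k)ᴴ = _
  rw [totalSpinOp_eq, tensorGenerator_conjTranspose, (spinOp_isHermitian b k).eq,
    (spinOp_isHermitian a k).eq]

lemma totalRaise_commutator :
    totalRaise a b * (totalRaise a b)ᴴ - (totalRaise a b)ᴴ * totalRaise a b =
      totalSpinOp a b 2 + totalSpinOp a b 2 := by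
  rw [totalRaise, tensorGenerator_conjTranspose, tensorGenerator_commutator,
    spinRaise_commutator, spinRaise_commutator, tensorGenerator_smul, two_smul, ← totalSpinOp_eq]

lemma totalSpinOp_two_commutator :
    totalSpinOp a b 2 * totalRaise a b - totalRaise a b * totalSpinOp a b 2 =
      totalRaise a b := by
  rw [totalRaise, totalSpinOp_eq, tensorGenerator_commutator, spinOp_two_commutator,
    spinOp_two_commutator]

lemma totalSpinOp_two_commutator_conjTranspose :
    totalSpinOp a b 2 * (totalRaise a b)ᴴ - (totalRaise a b)ᴴ * totalSpinOp a b 2 =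
      -(totalRaise a b)ᴴ := by
  have h := congrArg conjTranspose (totalSpinOp_two_commutator a b)
  rw [conjTranspose_sub, conjTranspose_mul, conjTranspose_mul,
    (totalSpinOp_isHermitian a b 2).eq] at h
  rw [← neg_sub, h]

/-- With J₊ moved to the right, only the terms m² + m survive on a vector of weight m that J₊
annihilates. -/
lemma casimir_eq :
    casimir a b = (totalRaise a b)ᴴ * totalRaise a b +
      totalSpinOp a b 2 * totalSpinOp a b 2 + totalSpinOp a b 2 := by
  have h := totalRaise_commutator a b
  have key : casimir a b = (1 / 2 : ℂ) • (totalRaise a b * (totalRaise a b)ᴴ +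
      (totalRaise a b)ᴴ * totalRaise a b) + totalSpinOp a b 2 * totalSpinOp a b 2 := by
    rw [casimir, Fin.sum_univ_three, totalSpinOp_zero, totalSpinOp_one]
    simp only [smul_mul_smul_comm, add_mul, mul_add, sub_mul, mul_sub]
    have : -Complex.I / 2 * (-Complex.I / 2) = -(1 / 4) := by
      linear_combination (1 / 4 : ℂ) * Complex.I_mul_I
    rw [this]
    module
  rw [key, sub_eq_iff_eq_add.1 h]
  module

lemma casimir_isHermitian : (casimir a b).IsHermitian := by
  change (casimir a b)ᴴ = _
  simp only [casimir, conjTranspose_sum, conjTranspose_mul, (totalSpinOp_isHermitian a b _).eq]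

lemma commute_casimir_totalRaise : Commute (casimir a b) (totalRaise a b) := by
  rw [casimir_eq]
  exact commute_casimir_raise (totalSpinOp_two_commutator a b) (totalRaise_commutator a b)

lemma commute_casimir_conjTranspose : Commute (casimir a b) (totalRaise a b)ᴴ := by
  have h := congrArg conjTranspose (commute_casimir_totalRaise a b).eq
  rw [conjTranspose_mul, conjTranspose_mul, (casimir_isHermitian a b).eq] at h
  exact h.symm

lemma commute_casimir_totalSpinOp (k : Fin 3) : Commute (casimir a b) (totalSpinOp a b k) := by
  fin_cases k
  · change Commute _ (totalSpinOp a b 0)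
    rw [totalSpinOp_zero]
    exact ((commute_casimir_totalRaise a b).add_right
      (commute_casimir_conjTranspose a b)).smul_right _
  · change Commute _ (totalSpinOp a b 1)
    rw [totalSpinOp_one]
    exact ((commute_casimir_totalRaise a b).sub_right
      (commute_casimir_conjTranspose a b)).smul_right _
  · change Commute _ (totalSpinOp a b 2)
    rw [casimir_eq]
    exact commute_casimir_weight (totalSpinOp_two_commutator a b)
      (totalSpinOp_two_commutator_conjTranspose a b)

/-- The Casimir operator in terms of the coupling of the two spins. -/
lemma casimir_eq_coupling :
    casimir a b = ((spin b * (spin b + 1) + spin a * (spin a + 1) : ℝ) : ℂ) • 1 -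
      (2 : ℂ) • ∑ k, spinOp b k ⊗ₖ (spinOp a k)ᵀ := by
  have h1 : ∀ k, totalSpinOp a b k * totalSpinOp a b k =
      (spinOp b k * spinOp b k) ⊗ₖ (1 : Op a) + (1 : Op b) ⊗ₖ (spinOp a k * spinOp a k)ᵀ -
        (2 : ℂ) • (spinOp b k ⊗ₖ (spinOp a k)ᵀ) := by
    intro k
    simp only [totalSpinOp, mul_sub, sub_mul, ← mul_kronecker_mul, mul_one, one_mul,
      transpose_mul]
    module
  have hl : ∀ f : Fin 3 → Op b, ∑ k, f k ⊗ₖ (1 : Op a) = (∑ k, f k) ⊗ₖ (1 : Op a) := by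
    intro f; simp only [Fin.sum_univ_three, add_kronecker]
  have hr : ∀ f : Fin 3 → Op a, ∑ k, (1 : Op b) ⊗ₖ (f k)ᵀ = (1 : Op b) ⊗ₖ (∑ k, f k)ᵀ := by
    intro f; simp only [Fin.sum_univ_three, kronecker_add, transpose_add]
  rw [casimir, Finset.sum_congr rfl fun k _ => h1 k, Finset.sum_sub_distrib,
    Finset.sum_add_distrib, hl, hr, sum_spinOp_sq, sum_spinOp_sq, ← Finset.smul_sum,
    transpose_smul, transpose_one, smul_kronecker, kronecker_smul, one_kronecker_one,
    Complex.ofReal_add, add_smul]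

end Total

/-! ### Highest-weight vectors. -/

section HighestWeight

variable {a b : ℕ} {w : Fin (b + 1) × Fin (a + 1) → ℂ}

lemma totalRaise_mulVec_apply (w : Fin (b + 1) × Fin (a + 1) → ℂ)
    (i : Fin (b + 1)) (p : Fin (a + 1)) :
    (totalRaise a b *ᵥ w) (i, p) =
      ∑ i', spinRaise b i i' * w (i', p) - ∑ p', spinRaise a p' p * w (i, p') :=
  tensorGenerator_mulVec_apply _ _ _ _ _

/-- A vector annihilated by the raising operator is determined by its components along
`|j_B, j_B⟩ ⊗ |p⟩`. -/
lemma eq_zero_of_first_row (hw : totalRaise a b *ᵥ w = 0) (h0 : ∀ p, w (0, p) = 0) : w = 0 := by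
  have h : ∀ (m : ℕ) (hm : m < b + 1) (p : Fin (a + 1)), w (⟨m, hm⟩, p) = 0 := by
    intro m
    induction m with
    | zero => exact fun _ p => h0 p
    | succ m ih =>
      intro hm p
      have h := congrFun hw (⟨m, by omega⟩, p)
      rw [totalRaise_mulVec_apply, Finset.sum_eq_single (⟨m + 1, hm⟩ : Fin (b + 1)),
        Finset.sum_eq_zero (f := fun p' => _ * _), sub_zero] at h
      · exact (mul_eq_zero.1 h).resolve_left (spinRaise_ne_zero rfl)
      · intro p' _
        rw [ih (by omega), mul_zero]
      · intro x _ hx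
        rw [spinRaise_eq_zero, zero_mul]
        exact fun h => hx (Fin.ext h.symm)
      · simp
  ext ⟨i, p⟩
  exact h i i.2 p

/-- A vector annihilated by the raising operator is determined by its components along
`|i⟩ ⊗ |j_A, -j_A⟩`. -/
lemma eq_zero_of_last_column (hw : totalRaise a b *ᵥ w = 0)
    (h0 : ∀ i, w (i, Fin.last a) = 0) : w = 0 := by
  have h : ∀ (m : ℕ) (hm : m ≤ a) (i : Fin (b + 1)), w (i, ⟨a - m, by omega⟩) = 0 := by
    intro m
    induction m with
    | zero => exact fun _ i => h0 i
    | succ m ih =>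
      intro hm i
      have h := congrFun hw (i, ⟨a - m, by omega⟩)
      rw [totalRaise_mulVec_apply, Finset.sum_eq_zero (f := fun i' => _ * _),
        Finset.sum_eq_single (⟨a - (m + 1), by omega⟩ : Fin (a + 1)), zero_sub] at h
      · refine (mul_eq_zero.1 (neg_eq_zero.1 h)).resolve_left (spinRaise_ne_zero ?_)
        simp only []
        omega
      · intro x _ hx
        rw [spinRaise_eq_zero, zero_mul]
        intro h
        simp only [] at h
        exact hx (Fin.ext (by simp only []; omega))
      · simp
      · intro i' _
        rw [ih (by omega), mul_zero]
  ext ⟨i, p⟩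
  have := h (a - p) (by omega) i
  have hp : (⟨a - (a - p), by omega⟩ : Fin (a + 1)) = p := Fin.ext (by simp only []; omega)
  rwa [hp] at this

lemma weight_eq_of_ne_zero {m : ℝ} (hm : totalSpinOp a b 2 *ᵥ w = (m : ℂ) • w)
    {x : Fin (b + 1) × Fin (a + 1)} (hx : w x ≠ 0) : weight a b x = m := by
  have h := congrFun hm x
  rw [totalSpinOp_two, mulVec_diagonal, Pi.smul_apply, smul_eq_mul] at h
  exact_mod_cast mul_right_cancel₀ hx h

/-- Such a vector has a nonzero component in the last column, where weights are at least j_A - j_B,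
and one in the first row, where weights are at least j_B - j_A. -/
lemma weight_ge_of_highest (hw0 : w ≠ 0) (hw : totalRaise a b *ᵥ w = 0) {m : ℝ}
    (hm : totalSpinOp a b 2 *ᵥ w = (m : ℂ) • w) : |spin a - spin b| ≤ m := by
  rw [abs_le']
  constructor
  · by_contra hlt
    refine hw0 (eq_zero_of_last_column hw fun i => ?_)
    by_contra hi
    have h := weight_eq_of_ne_zero hm hi
    have hib : ((i : ℕ) : ℝ) ≤ b := by exact_mod_cast Nat.lt_succ_iff.1 i.2
    simp only [weight, magnetic, spin, Fin.val_last] at h hlt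
    linarith
  · by_contra hlt
    refine hw0 (eq_zero_of_first_row hw fun p => ?_)
    by_contra hp
    have h := weight_eq_of_ne_zero hm hp
    have hpa : (0 : ℝ) ≤ ((p : ℕ) : ℝ) := Nat.cast_nonneg _
    simp only [weight, magnetic, spin, Fin.val_zero, Nat.cast_zero] at h hlt
    linarith

/-- Highest-weight vectors of equal weight are proportional. -/
lemma highest_unique {v : Fin (b + 1) × Fin (a + 1) → ℂ} {m : ℝ} (hv0 : v ≠ 0)
    (hv : totalRaise a b *ᵥ v = 0) (hvm : totalSpinOp a b 2 *ᵥ v = (m : ℂ) • v)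
    (hw : totalRaise a b *ᵥ w = 0) (hwm : totalSpinOp a b 2 *ᵥ w = (m : ℂ) • w) :
    ∃ c : ℂ, w = c • v := by
  -- A fixed weight allows only one nonzero entry in row `0`, and that row determines the vector, so
  -- matching this entry suffices.
  obtain ⟨p, hp⟩ : ∃ p, v (0, p) ≠ 0 := by
    by_contra! h
    exact hv0 (eq_zero_of_first_row hv h)
  refine ⟨w (0, p) / v (0, p), ?_⟩
  rw [← sub_eq_zero]
  apply eq_zero_of_first_row
  · rw [mulVec_sub, mulVec_smul, hv, hw, smul_zero, sub_zero]
  · intro q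
    by_cases hq : q = p
    · subst hq
      simp [div_mul_cancel₀ _ hp]
    · have hne : weight a b (0, q) ≠ m := by
        rw [← weight_eq_of_ne_zero hvm hp]
        simp only [weight, magnetic]
        intro h
        apply hq
        have : ((q : ℕ) : ℝ) = (p : ℕ) := by linarith
        exact Fin.ext (by exact_mod_cast this)
      have h1 : v (0, q) = 0 := by
        by_contra h
        exact hne (weight_eq_of_ne_zero hvm h)
      have h2 : w (0, q) = 0 := by
        by_contra h
        exact hne (weight_eq_of_ne_zero hwm h)
      simp [h1, h2]

lemma casimir_mulVec_of_highest (hw : totalRaise a b *ᵥ w = 0) {m : ℝ}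
    (hm : totalSpinOp a b 2 *ᵥ w = (m : ℂ) • w) :
    casimir a b *ᵥ w = ((m * (m + 1) : ℝ) : ℂ) • w := by
  rw [casimir_eq, add_mulVec, add_mulVec, ← mulVec_mulVec, ← mulVec_mulVec, hw, hm, mulVec_zero,
    mulVec_smul, hm]
  push_cast
  module

/-- Every non-zero invariant subspace contains a highest-weight vector. -/
lemma exists_highest {W : Submodule ℂ (Fin (b + 1) × Fin (a + 1) → ℂ)} (hW : W ≠ ⊥)
    (hp : ∀ w ∈ W, totalRaise a b *ᵥ w ∈ W) (hz : ∀ w ∈ W, totalSpinOp a b 2 *ᵥ w ∈ W) :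
    ∃ w ∈ W, w ≠ 0 ∧ totalRaise a b *ᵥ w = 0 ∧
      ∃ m : ℝ, totalSpinOp a b 2 *ᵥ w = (m : ℂ) • w := by
  classical
  -- Basis indices whose weight occurs in `W`. Raising an eigenvector of maximal weight must give
  -- zero, since the result would otherwise have weight one larger.
  let S : Set (Fin (b + 1) × Fin (a + 1)) :=
    {x | ∃ w ∈ W, w ≠ 0 ∧ totalSpinOp a b 2 *ᵥ w = ((weight a b x : ℝ) : ℂ) • w}
  have hmem : ∀ w ∈ W, w ≠ 0 → ∀ c : ℂ, totalSpinOp a b 2 *ᵥ w = c • w →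
      ∃ x ∈ S, c = ((weight a b x : ℝ) : ℂ) := by
    intro w hwW hw0 c hc
    obtain ⟨x, hx⟩ : ∃ x, w x ≠ 0 := by
      by_contra! h
      exact hw0 (funext h)
    have h := congrFun hc x
    rw [totalSpinOp_two, mulVec_diagonal, Pi.smul_apply, smul_eq_mul] at h
    have h' := mul_right_cancel₀ hx h
    exact ⟨x, ⟨w, hwW, hw0, by rw [hc, h']⟩, h'.symm⟩
  have hS : S.Nonempty := by
    have : Nontrivial W := Submodule.nontrivial_iff_ne_bot.2 hW
    obtain ⟨c, hc⟩ := Module.End.exists_eigenvalue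
      ((Matrix.mulVecLin (totalSpinOp a b 2)).restrict (p := W) (q := W) hz)
    obtain ⟨⟨w, hwW⟩, hw⟩ := hc.exists_hasEigenvector
    have h1 := congrArg Subtype.val hw.apply_eq_smul
    obtain ⟨x, hx, -⟩ := hmem w hwW (fun h => hw.2 (Subtype.ext h)) c h1
    exact ⟨x, hx⟩
  obtain ⟨x, ⟨w, hwW, hw0, hwx⟩, hmax⟩ := Set.exists_max_image S (weight a b) S.toFinite hS
  refine ⟨w, hwW, hw0, ?_, _, hwx⟩
  by_contra hne
  obtain ⟨y, hy, hyx⟩ := hmem _ (hp w hwW) hne (((weight a b x : ℝ) : ℂ) + 1) (by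
    rw [mulVec_mulVec, sub_eq_iff_eq_add.1 (totalSpinOp_two_commutator a b), add_mulVec,
      ← mulVec_mulVec, hwx, mulVec_smul]
    module)
  have h := hmax y hy
  have h' : weight a b x + 1 = weight a b y := by exact_mod_cast hyx
  linarith

end HighestWeight

/-! ### The lower bound on the Casimir operator. -/

variable {a b : ℕ}

/-- The smallest total angular momentum `|j_A - j_B|`. -/
noncomputable def minSpin (a b : ℕ) : ℝ := |spin a - spin b|

lemma minSpin_nonneg (a b : ℕ) : 0 ≤ minSpin a b := abs_nonneg _

/-- The squared total angular momentum is bounded below by that of the smallest spin. -/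
lemma casimir_sub_posSemidef (a b : ℕ) :
    (casimir a b - ((minSpin a b * (minSpin a b + 1) : ℝ) : ℂ) • 1).PosSemidef := by
  set μ : ℝ := minSpin a b * (minSpin a b + 1) with hμ
  have hH : (casimir a b - (μ : ℂ) • 1).IsHermitian := by
    change (_ - _)ᴴ = _
    rw [conjTranspose_sub, (casimir_isHermitian a b).eq, conjTranspose_smul, conjTranspose_one]
    simp
  rw [hH.posSemidef_iff_eigenvalues_nonneg]
  intro i
  change 0 ≤ hH.eigenvalues i
  set e := hH.eigenvalues i with he
  -- This Casimir eigenspace is invariant. A highest-weight vector in it has weight m with m(m+1) =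
  -- e + μ and m ≥ |j_A - j_B|, hence e ≥ 0.
  let W : Submodule ℂ (Fin (b + 1) × Fin (a + 1) → ℂ) :=
    LinearMap.ker (mulVecLin (casimir a b - ((e + μ : ℝ) : ℂ) • 1))
  have hmem : ∀ w, w ∈ W ↔ casimir a b *ᵥ w = ((e + μ : ℝ) : ℂ) • w := by
    intro w
    rw [LinearMap.mem_ker, mulVecLin_apply, sub_mulVec, smul_mulVec, one_mulVec, sub_eq_zero]
  have hcomm : ∀ M, Commute (casimir a b) M → ∀ w ∈ W, M *ᵥ w ∈ W := by
    intro M hM w hw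
    rw [hmem] at hw ⊢
    rw [mulVec_mulVec, hM.eq, ← mulVec_mulVec, hw, mulVec_smul]
  have hW : W ≠ ⊥ := by
    have h := hH.mulVec_eigenvectorBasis i
    rw [sub_mulVec, smul_mulVec, one_mulVec, sub_eq_iff_eq_add] at h
    intro hbot
    have h0 : (hH.eigenvectorBasis i).ofLp ∈ W := by
      rw [hmem, h, ← he]
      ext x
      simp [add_mul]
    rw [hbot, Submodule.mem_bot] at h0
    have h1 := hH.eigenvectorBasis.orthonormal.ne_zero i
    exact h1 (WithLp.ofLp_injective 2 h0)
  obtain ⟨w, hwW, hw0, hwp, m, hm⟩ := exists_highest hW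
    (hcomm _ (commute_casimir_totalRaise a b)) (hcomm _ (commute_casimir_totalSpinOp a b 2))
  have h1 := (hmem w).1 hwW
  rw [casimir_mulVec_of_highest hwp hm] at h1
  have h2 : m * (m + 1) = e + μ := by
    exact_mod_cast smul_left_injective ℂ hw0 h1
  have h3 : minSpin a b ≤ m := weight_ge_of_highest hw0 hwp hm
  have h4 := minSpin_nonneg a b
  nlinarith

/-! ### Projections onto Casimir eigenspaces. -/

section Projection

variable {L : ℝ}

lemma totalSpinProjection_mulVec (a b : ℕ) (L : ℝ) (v : Fin (b + 1) × Fin (a + 1) → ℂ) :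
    totalSpinProjection a b L *ᵥ v =
      ((totalSpinSubspace a b L).starProjection (WithLp.toLp 2 v)).ofLp := by
  have h : Matrix.toEuclideanLin (totalSpinProjection a b L) =
      (totalSpinSubspace a b L).starProjection.toLinearMap :=
    LinearEquiv.apply_symm_apply _ _
  have h2 := congrArg WithLp.ofLp (LinearMap.congr_fun h (WithLp.toLp 2 v))
  rwa [Matrix.ofLp_toLpLin, Matrix.toLin'_apply] at h2

lemma mem_totalSpinSubspace {v : Fin (b + 1) × Fin (a + 1) → ℂ} :
    WithLp.toLp 2 v ∈ totalSpinSubspace a b L ↔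
      casimir a b *ᵥ v = ((L * (L + 1) : ℝ) : ℂ) • v := by
  rw [totalSpinSubspace, Module.End.mem_eigenspace_iff, Matrix.toLpLin_toLp, Matrix.toLin'_apply,
    ← WithLp.toLp_smul]
  exact (WithLp.toLp_injective 2).eq_iff

lemma totalSpinProjection_isHermitian (a b : ℕ) (L : ℝ) :
    (totalSpinProjection a b L).IsHermitian := by
  rw [← Matrix.isSymmetric_toEuclideanLin_iff, totalSpinProjection, LinearEquiv.apply_symm_apply]
  exact Submodule.starProjection_isSymmetric _

lemma totalSpinProjection_mulVec_eq_self {v : Fin (b + 1) × Fin (a + 1) → ℂ}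
    (hv : casimir a b *ᵥ v = ((L * (L + 1) : ℝ) : ℂ) • v) :
    totalSpinProjection a b L *ᵥ v = v := by
  rw [totalSpinProjection_mulVec,
    Submodule.starProjection_eq_self_iff.2 (mem_totalSpinSubspace.2 hv)]

lemma casimir_mulVec_projection (v : Fin (b + 1) × Fin (a + 1) → ℂ) :
    casimir a b *ᵥ (totalSpinProjection a b L *ᵥ v) =
      ((L * (L + 1) : ℝ) : ℂ) • (totalSpinProjection a b L *ᵥ v) := by
  rw [← mem_totalSpinSubspace, totalSpinProjection_mulVec]
  exact Submodule.starProjection_apply_mem _ _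

lemma projection_mul_self (a b : ℕ) (L : ℝ) :
    totalSpinProjection a b L * totalSpinProjection a b L = totalSpinProjection a b L := by
  apply ext_of_mulVec_single
  intro i
  rw [← mulVec_mulVec, totalSpinProjection_mulVec_eq_self (casimir_mulVec_projection _)]

lemma projection_posSemidef (a b : ℕ) (L : ℝ) : (totalSpinProjection a b L).PosSemidef := by
  have h := posSemidef_conjTranspose_mul_self (totalSpinProjection a b L)
  rwa [(totalSpinProjection_isHermitian a b L).eq, projection_mul_self] at h

lemma casimir_mul_projection (a b : ℕ) (L : ℝ) :
    casimir a b * totalSpinProjection a b L =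
      ((L * (L + 1) : ℝ) : ℂ) • totalSpinProjection a b L := by
  apply ext_of_mulVec_single
  intro i
  rw [← mulVec_mulVec, casimir_mulVec_projection, smul_mulVec]

lemma projection_mul_mul {M : Matrix (Fin (b + 1) × Fin (a + 1)) (Fin (b + 1) × Fin (a + 1)) ℂ}
    (hM : Commute (casimir a b) M) :
    totalSpinProjection a b L * (M * totalSpinProjection a b L) =
      M * totalSpinProjection a b L := by
  apply ext_of_mulVec_single
  intro i
  rw [← mulVec_mulVec]
  apply totalSpinProjection_mulVec_eq_self
  rw [mulVec_mulVec, ← mul_assoc, hM.eq, mul_assoc, casimir_mul_projection, mul_smul_comm,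
    smul_mulVec]

/-- Both `M` and `Mᴴ` preserve the eigenspace, so `M` also preserves its orthogonal complement. -/
lemma commute_projection {M : Matrix (Fin (b + 1) × Fin (a + 1)) (Fin (b + 1) × Fin (a + 1)) ℂ}
    (hM : Commute (casimir a b) M) (hM' : Commute (casimir a b) Mᴴ) :
    Commute (totalSpinProjection a b L) M := by
  have h := congrArg conjTranspose (projection_mul_mul (L := L) hM')
  simp only [conjTranspose_mul, conjTranspose_conjTranspose,
    (totalSpinProjection_isHermitian a b L).eq] at h
  change _ * _ = _ * _
  rw [← h, mul_assoc, projection_mul_mul hM]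

lemma commute_projection_totalSpinOp (k : Fin 3) :
    Commute (totalSpinProjection a b L) (totalSpinOp a b k) := by
  apply commute_projection (commute_casimir_totalSpinOp a b k)
  rw [(totalSpinOp_isHermitian a b k).eq]
  exact commute_casimir_totalSpinOp a b k

lemma commute_projection_totalRaise :
    Commute (totalSpinProjection a b L) (totalRaise a b) :=
  commute_projection (commute_casimir_totalRaise a b) (commute_casimir_conjTranspose a b)

lemma commute_projection_conjTranspose :
    Commute (totalSpinProjection a b L) (totalRaise a b)ᴴ :=
  commute_projection (commute_casimir_conjTranspose a b) (by
    rw [conjTranspose_conjTranspose]; exact commute_casimir_totalRaise a b)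

end Projection

/-! ### Irreducibility of the subspace of smallest total spin. -/

/-- The highest-weight vector of the subspace of smallest total angular momentum. -/
noncomputable def lowestHighestVector (a b : ℕ) : Fin (b + 1) × Fin (a + 1) → ℂ := fun x =>
  -- The subtraction is truncated, so the offset is `max (a - b) 0`; the condition selects the
  -- product vectors of weight |j_A - j_B|.
  if (x.2 : ℕ) = x.1 + (a - b) then
    ((∏ k ∈ Finset.range x.1, √(ladder a (k + (a - b) + 1)) / √(ladder b (k + 1)) : ℝ) : ℂ)
  else 0

lemma lowestHighestVector_ne_zero (a b : ℕ) : lowestHighestVector a b ≠ 0 := by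
  intro h
  have h1 := congrFun h (0, ⟨a - b, by omega⟩)
  simp [lowestHighestVector] at h1

lemma weight_eq_minSpin {x : Fin (b + 1) × Fin (a + 1)} (hx : (x.2 : ℕ) = x.1 + (a - b)) :
    weight a b x = minSpin a b := by
  simp only [weight, magnetic, minSpin, spin, hx]
  rcases le_total b a with h | h
  · have h' : (b : ℝ) ≤ a := by exact_mod_cast h
    rw [abs_of_nonneg (by linarith)]
    push_cast [Nat.cast_sub h]
    ring
  · have h' : (a : ℝ) ≤ b := by exact_mod_cast h
    rw [abs_of_nonpos (by linarith), Nat.sub_eq_zero_of_le h]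
    push_cast
    ring

lemma totalSpinOp_mulVec_lowestHighestVector (a b : ℕ) :
    totalSpinOp a b 2 *ᵥ lowestHighestVector a b =
      ((minSpin a b : ℝ) : ℂ) • lowestHighestVector a b := by
  ext x
  rw [totalSpinOp_two, mulVec_diagonal, Pi.smul_apply, smul_eq_mul]
  by_cases hx : (x.2 : ℕ) = x.1 + (a - b)
  · rw [weight_eq_minSpin hx]
  · simp [lowestHighestVector, hx]

/-- The component at `(i, p)` involves only the entries at `(i + 1, p)` and `(i, p - 1)`, and the
ratio of successive products is chosen to cancel these two terms. -/
lemma totalRaise_mulVec_lowestHighestVector (a b : ℕ) :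
    totalRaise a b *ᵥ lowestHighestVector a b = 0 := by
  ext ⟨i, p⟩
  rw [totalRaise_mulVec_apply, Pi.zero_apply]
  by_cases hp : (p : ℕ) = i + 1 + (a - b)
  · have hi : (i : ℕ) + 1 < b + 1 := by omega
    rw [Finset.sum_eq_single (⟨i + 1, hi⟩ : Fin (b + 1)),
      Finset.sum_eq_single (⟨i + (a - b), by omega⟩ : Fin (a + 1))]
    · rw [spinRaise_apply, if_pos rfl, spinRaise_apply, if_pos (by simp only []; omega)]
      simp only [lowestHighestVector, hp, if_true]
      rw [← Complex.ofReal_mul, ← Complex.ofReal_mul, ← Complex.ofReal_sub, Finset.prod_range_succ]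
      have h0 : √(ladder b (i + 1)) ≠ 0 :=
        (Real.sqrt_pos.2 (ladder_pos (by omega) (by omega))).ne'
      have h1 : (i : ℕ) + 1 + (a - b) = i + (a - b) + 1 := by omega
      rw [h1]
      norm_cast
      field_simp
      ring
    · intro x _ hx
      rw [spinRaise_eq_zero, zero_mul]
      exact fun h => hx (Fin.ext (by simp only []; omega))
    · simp
    · intro x _ hx
      rw [spinRaise_eq_zero, zero_mul]
      exact fun h => hx (Fin.ext h.symm)
    · simp
  · rw [Finset.sum_eq_zero, Finset.sum_eq_zero, sub_zero]
    · intro x _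
      by_cases hx : (x : ℕ) + 1 = p
      · rw [lowestHighestVector, if_neg, mul_zero]
        simp only []
        omega
      · rw [spinRaise_eq_zero hx, zero_mul]
    · intro x _
      by_cases hx : (i : ℕ) + 1 = x
      · rw [lowestHighestVector, if_neg, mul_zero]
        simp only []
        omega
      · rw [spinRaise_eq_zero hx, zero_mul]

lemma projection_mulVec_lowestHighestVector (a b : ℕ) :
    totalSpinProjection a b (minSpin a b) *ᵥ lowestHighestVector a b =
      lowestHighestVector a b :=
  totalSpinProjection_mulVec_eq_self (casimir_mulVec_of_highest
    (totalRaise_mulVec_lowestHighestVector a b) (totalSpinOp_mulVec_lowestHighestVector a b))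

/-- Irreducibility of the subspace of smallest total angular momentum. -/
lemma eq_smul_projection_of_commute
    {Q : Matrix (Fin (b + 1) × Fin (a + 1)) (Fin (b + 1) × Fin (a + 1)) ℂ}
    (hQ : ∀ k, Commute (totalSpinOp a b k) Q)
    (hQP : Q * totalSpinProjection a b (minSpin a b) = Q) :
    ∃ c : ℂ, Q = c • totalSpinProjection a b (minSpin a b) := by
  set P := totalSpinProjection a b (minSpin a b) with hP
  set v := lowestHighestVector a b with hv
  have hraise : totalRaise a b = totalSpinOp a b 0 + Complex.I • totalSpinOp a b 1 := by
    rw [totalSpinOp_zero, totalSpinOp_one, smul_smul]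
    have : Complex.I * (-Complex.I / 2) = 1 / 2 := by
      linear_combination (-1 / 2 : ℂ) * Complex.I_mul_I
    rw [this]
    module
  have hQp : Commute (totalRaise a b) Q := by
    rw [hraise]
    exact (hQ 0).add_left ((hQ 1).smul_left _)
  have hQm : Commute (totalRaise a b)ᴴ Q := by
    rw [hraise, conjTranspose_add, conjTranspose_smul, (totalSpinOp_isHermitian a b 0).eq,
      (totalSpinOp_isHermitian a b 1).eq]
    exact (hQ 0).add_left ((hQ 1).smul_left _)
  obtain ⟨c, hc⟩ : ∃ c : ℂ, Q *ᵥ v = c • v := by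
    apply highest_unique (lowestHighestVector_ne_zero a b)
      (totalRaise_mulVec_lowestHighestVector a b) (totalSpinOp_mulVec_lowestHighestVector a b)
    · rw [mulVec_mulVec, hQp.eq, ← mulVec_mulVec, totalRaise_mulVec_lowestHighestVector,
        mulVec_zero]
    · rw [mulVec_mulVec, (hQ 2).eq, ← mulVec_mulVec, totalSpinOp_mulVec_lowestHighestVector,
        mulVec_smul]
  refine ⟨c, ?_⟩
  rw [← sub_eq_zero]
  -- `D` annihilates `v`. If `D ≠ 0`, the range of `Dᴴ` is a nonzero subspace of the range of `P`,
  -- stable under J₊ and J^z, so it has a highest-weight vector `Dᴴ u`, necessarily a multiple of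
  -- `v`. Then `D Dᴴ u = 0` gives `Dᴴ u = 0`, a contradiction.
  set D := Q - c • P with hD
  have hDv : D *ᵥ v = 0 := by
    rw [hD, sub_mulVec, hc, smul_mulVec, projection_mulVec_lowestHighestVector, sub_self]
  have hDP : P * Dᴴ = Dᴴ := by
    have h : D * P = D := by
      rw [hD, sub_mul, hQP, smul_mul_assoc, projection_mul_self]
    have h' := congrArg conjTranspose h
    rwa [conjTranspose_mul, (totalSpinProjection_isHermitian a b _).eq] at h'
  have hDp : Commute (totalRaise a b) Dᴴ := by
    have h : Commute (totalRaise a b)ᴴ D :=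
      hQm.sub_right ((commute_projection_conjTranspose.symm).smul_right c)
    have h' := congrArg conjTranspose h.eq
    rw [conjTranspose_mul, conjTranspose_mul, conjTranspose_conjTranspose] at h'
    exact h'.symm
  have hDz : Commute (totalSpinOp a b 2) Dᴴ := by
    have h : Commute (totalSpinOp a b 2) D :=
      (hQ 2).sub_right (((commute_projection_totalSpinOp 2).symm).smul_right c)
    have h' := congrArg conjTranspose h.eq
    rw [conjTranspose_mul, conjTranspose_mul, (totalSpinOp_isHermitian a b 2).eq] at h'
    exact h'.symm
  by_contra hne
  let W : Submodule ℂ (Fin (b + 1) × Fin (a + 1) → ℂ) := LinearMap.range (mulVecLin Dᴴ)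
  have hW : W ≠ ⊥ := by
    intro h
    rw [LinearMap.range_eq_bot] at h
    apply hne
    rw [← conjTranspose_eq_zero]
    apply ext_of_mulVec_single
    intro i
    rw [← mulVecLin_apply, h, zero_mulVec, LinearMap.zero_apply]
  have hinv : ∀ M, Commute M Dᴴ → ∀ w ∈ W, M *ᵥ w ∈ W := by
    rintro M hM w ⟨u, rfl⟩
    exact ⟨M *ᵥ u, by rw [mulVecLin_apply, mulVecLin_apply, mulVec_mulVec, mulVec_mulVec, hM.eq]⟩
  obtain ⟨w, ⟨u, hu⟩, hw0, hwp, m, hm⟩ := exists_highest hW (hinv _ hDp) (hinv _ hDz)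
  rw [mulVecLin_apply] at hu
  have hwP : P *ᵥ w = w := by rw [← hu, mulVec_mulVec, hDP]
  have h1 := casimir_mulVec_of_highest hwp hm
  have h2 := casimir_mulVec_projection (L := minSpin a b) w
  rw [← hP, hwP, h1] at h2
  have h3 : m * (m + 1) = minSpin a b * (minSpin a b + 1) := by
    exact_mod_cast smul_left_injective ℂ hw0 h2
  have h4 : minSpin a b ≤ m := weight_ge_of_highest hw0 hwp hm
  have h5 : m = minSpin a b := by
    have := minSpin_nonneg a b
    nlinarith
  rw [h5] at hm
  obtain ⟨d, hd⟩ := highest_unique (lowestHighestVector_ne_zero a b)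
      (totalRaise_mulVec_lowestHighestVector a b) (totalSpinOp_mulVec_lowestHighestVector a b)
      hwp hm
  have h6 : (D * Dᴴ) *ᵥ u = 0 := by
    rw [← mulVec_mulVec, hu, hd, mulVec_smul, hDv, smul_zero]
  rw [self_mul_conjTranspose_mulVec_eq_zero] at h6
  exact hw0 (hu ▸ h6)

/-! ### Weight multiplicities and the dimension count. -/

/-- The integer `p - i`, which differs from the weight of `|i⟩ ⊗ |p⟩` by a constant. -/
def degree (x : Fin (b + 1) × Fin (a + 1)) : ℤ := (x.2 : ℤ) - (x.1 : ℤ)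

lemma weight_eq_degree (x : Fin (b + 1) × Fin (a + 1)) :
    weight a b x = (degree x : ℝ) + (spin b - spin a) := by
  simp only [weight, magnetic, degree]
  push_cast
  ring

/-- The projection onto a weight space. -/
noncomputable def weightProjection (a b : ℕ) (s : ℤ) :
    Matrix (Fin (b + 1) × Fin (a + 1)) (Fin (b + 1) × Fin (a + 1)) ℂ :=
  diagonal fun x => if degree x = s then 1 else 0

lemma totalSpinOp_mul_weightProjection (a b : ℕ) (s : ℤ) :
    totalSpinOp a b 2 * weightProjection a b s =
      (((s : ℝ) + (spin b - spin a) : ℝ) : ℂ) • weightProjection a b s := by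
  rw [totalSpinOp_two, weightProjection, diagonal_mul_diagonal, ← diagonal_smul]
  congr 1
  ext x
  rw [weight_eq_degree, Pi.smul_apply]
  split_ifs with h
  · rw [h, smul_eq_mul]
  · simp

lemma totalRaise_eq_zero {x y : Fin (b + 1) × Fin (a + 1)} (h : degree x ≠ degree y + 1) :
    totalRaise a b x y = 0 := by
  have h1 := congrFun (congrFun (totalSpinOp_two_commutator a b) x) y
  rw [totalSpinOp_two, Matrix.sub_apply, diagonal_mul, mul_diagonal, weight_eq_degree,
    weight_eq_degree] at h1
  have h2 : ((degree x : ℂ) - (degree y + 1)) * totalRaise a b x y = 0 := by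
    push_cast at h1
    linear_combination h1
  refine (mul_eq_zero.1 h2).resolve_left fun h3 => h ?_
  exact_mod_cast sub_eq_zero.1 h3

lemma totalRaise_mul_weightProjection (a b : ℕ) (s : ℤ) :
    totalRaise a b * weightProjection a b s = weightProjection a b (s + 1) * totalRaise a b := by
  ext x y
  rw [weightProjection, weightProjection, mul_diagonal, diagonal_mul]
  by_cases h : degree x = degree y + 1
  · by_cases hy : degree y = s
    · simp [h, hy]
    · simp [h, hy]
  · simp [totalRaise_eq_zero h]

/-- The multiplicity of a weight in the subspace of smallest total angular momentum. -/
noncomputable def multiplicity (a b : ℕ) (s : ℤ) : ℂ :=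
  (totalSpinProjection a b (minSpin a b) * weightProjection a b s).trace

lemma multiplicity_eq_zero {s : ℤ} (hs : ∀ x : Fin (b + 1) × Fin (a + 1), degree x ≠ s) :
    multiplicity a b s = 0 := by
  have : weightProjection a b s = 0 := by
    rw [weightProjection, ← diagonal_zero]
    congr 1
    ext x
    rw [if_neg (hs x)]
  rw [multiplicity, this, mul_zero, trace_zero]

lemma projection_mul_lower_raise (s : ℤ) :
    totalSpinProjection a b (minSpin a b) * ((totalRaise a b)ᴴ * totalRaise a b) *
        weightProjection a b s =
      ((minSpin a b * (minSpin a b + 1) - ((s : ℝ) + (spin b - spin a)) *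
        ((s : ℝ) + (spin b - spin a) + 1) : ℝ) : ℂ) •
        (totalSpinProjection a b (minSpin a b) * weightProjection a b s) := by
  have h : (totalRaise a b)ᴴ * totalRaise a b =
      casimir a b - totalSpinOp a b 2 * totalSpinOp a b 2 - totalSpinOp a b 2 := by
    rw [casimir_eq]; abel
  have hC : totalSpinProjection a b (minSpin a b) * casimir a b =
      ((minSpin a b * (minSpin a b + 1) : ℝ) : ℂ) • totalSpinProjection a b (minSpin a b) := by
    rw [(commute_projection (Commute.refl _) (by
      rw [(casimir_isHermitian a b).eq])).eq, casimir_mul_projection]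
  rw [h]
  simp only [mul_sub, sub_mul, hC]
  simp only [mul_assoc, totalSpinOp_mul_weightProjection, mul_smul_comm, smul_mul_assoc]
  rw [smul_smul, ← sub_smul, ← sub_smul]
  congr 1
  push_cast
  ring

lemma projection_mul_raise_lower (s : ℤ) :
    totalSpinProjection a b (minSpin a b) * (totalRaise a b * (totalRaise a b)ᴴ) *
        weightProjection a b (s + 1) =
      ((minSpin a b * (minSpin a b + 1) - ((s : ℝ) + (spin b - spin a)) *
        ((s : ℝ) + (spin b - spin a) + 1) : ℝ) : ℂ) •
        (totalSpinProjection a b (minSpin a b) * weightProjection a b (s + 1)) := by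
  have h : totalRaise a b * (totalRaise a b)ᴴ = (totalRaise a b)ᴴ * totalRaise a b +
      (totalSpinOp a b 2 + totalSpinOp a b 2) := by
    rw [← totalRaise_commutator]; abel
  rw [h, mul_add, add_mul, projection_mul_lower_raise]
  simp only [mul_add, add_mul, mul_assoc, totalSpinOp_mul_weightProjection, mul_smul_comm]
  rw [← add_smul, ← add_smul]
  congr 1
  push_cast
  ring

/-- On the bottom subspace, J₋J₊ in degree `s` and J₊J₋ in degree `s + 1` act by the same scalar,
and cyclicity equates their traces. The hypothesis says that this scalar is nonzero and can be
cancelled. -/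
lemma multiplicity_succ {s : ℤ}
    (hs : minSpin a b * (minSpin a b + 1) ≠
      ((s : ℝ) + (spin b - spin a)) * ((s : ℝ) + (spin b - spin a) + 1)) :
    multiplicity a b (s + 1) = multiplicity a b s := by
  have h1 := congrArg trace (projection_mul_raise_lower (a := a) (b := b) s)
  have h2 := congrArg trace (projection_mul_lower_raise (a := a) (b := b) s)
  have h3 : (totalSpinProjection a b (minSpin a b) * (totalRaise a b * (totalRaise a b)ᴴ) *
        weightProjection a b (s + 1)).trace =
      (totalSpinProjection a b (minSpin a b) * ((totalRaise a b)ᴴ * totalRaise a b) *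
        weightProjection a b s).trace := by
    rw [← mul_assoc, commute_projection_totalRaise.eq, trace_mul_comm, ← mul_assoc, ← mul_assoc,
      ← totalRaise_mul_weightProjection, mul_assoc, mul_assoc, trace_mul_comm,
      commute_projection_conjTranspose.eq, mul_assoc, mul_assoc, trace_mul_comm,
      ← mul_assoc (totalRaise a b)ᴴ, ← commute_projection_conjTranspose.eq]
    simp only [mul_assoc]
  rw [h3, h2, trace_smul, trace_smul, smul_eq_mul, smul_eq_mul] at h1
  refine (mul_left_cancel₀ ?_ h1).symm
  exact_mod_cast sub_ne_zero.2 hs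

/-- In the top degree every column of the product is a highest-weight vector, hence a multiple of
`v`. The matrix thus has rank-one form `v φᵀ`, and since it fixes `v` its trace `∑ φ y * v y` is
one. -/
lemma multiplicity_top (a b : ℕ) : multiplicity a b ((a - b : ℕ) : ℤ) = 1 := by
  set s : ℤ := ((a - b : ℕ) : ℤ) with hs
  set P := totalSpinProjection a b (minSpin a b) with hP
  set v := lowestHighestVector a b with hv
  have hm : (s : ℝ) + (spin b - spin a) = minSpin a b := by
    have h := weight_eq_degree (a := a) (b := b) (0, ⟨a - b, by omega⟩)
    rw [weight_eq_minSpin (by simp)] at h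
    rw [h]
    simp [degree, hs]
  have hcol : ∀ y, ∃ c : ℂ, ∀ x, (P * weightProjection a b s) x y = c * v x := by
    intro y
    obtain ⟨c, hc⟩ := highest_unique (a := a) (b := b)
      (w := (P * weightProjection a b s) *ᵥ Pi.single y 1) (lowestHighestVector_ne_zero a b)
      (totalRaise_mulVec_lowestHighestVector a b) (totalSpinOp_mulVec_lowestHighestVector a b)
      (by
        rw [← conjTranspose_mul_self_mulVec_eq_zero, mulVec_mulVec, ← mul_assoc,
          ← (commute_projection_conjTranspose.mul_right commute_projection_totalRaise).eq,
          projection_mul_lower_raise, hm]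
        simp only [sub_self, Complex.ofReal_zero, zero_smul, zero_mulVec])
      (by
        rw [mulVec_mulVec, ← mul_assoc, ← (commute_projection_totalSpinOp 2).eq, mul_assoc,
          totalSpinOp_mul_weightProjection, hm, mul_smul_comm, smul_mulVec])
    refine ⟨c, fun x => ?_⟩
    have h := congrFun hc x
    rwa [mulVec_single_one, Pi.smul_apply, smul_eq_mul] at h
  choose φ hφ using hcol
  have hfix : (P * weightProjection a b s) *ᵥ v = v := by
    rw [← mulVec_mulVec]
    have : weightProjection a b s *ᵥ v = v := by
      ext x
      rw [weightProjection, mulVec_diagonal]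
      by_cases hx : (x.2 : ℕ) = x.1 + (a - b)
      · rw [if_pos, one_mul]
        simp only [degree, hs]
        omega
      · simp [hv, lowestHighestVector, hx]
    rw [this]
    exact projection_mulVec_lowestHighestVector a b
  obtain ⟨x, hx⟩ : ∃ x, v x ≠ 0 := by
    by_contra! h
    exact lowestHighestVector_ne_zero a b (funext h)
  have h1 := congrFun hfix x
  simp only [mulVec, dotProduct, hφ] at h1
  have h2 : (∑ y, φ y * v y) * v x = 1 * v x := by
    rw [one_mul, Finset.sum_mul]
    refine Eq.trans (Finset.sum_congr rfl fun y _ => ?_) h1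
    ring
  rw [multiplicity, trace]
  simp only [diag_apply]
  rw [← mul_right_cancel₀ hx h2]
  exact Finset.sum_congr rfl fun y _ => hφ y y

lemma minSpin_eq_max (a b : ℕ) :
    minSpin a b = ((max ((a : ℤ) - b) 0 : ℤ) : ℝ) + (spin b - spin a) ∧
    -minSpin a b = ((min ((a : ℤ) - b) 0 : ℤ) : ℝ) + (spin b - spin a) := by
  simp only [minSpin, spin]
  rcases le_total b a with h | h
  · have h' : (b : ℝ) ≤ a := by exact_mod_cast h
    rw [abs_of_nonneg (by linarith), max_eq_left (by omega), min_eq_right (by omega)]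
    push_cast
    constructor <;> ring
  · have h' : (a : ℝ) ≤ b := by exact_mod_cast h
    rw [abs_of_nonpos (by linarith), max_eq_right (by omega), min_eq_left (by omega)]
    push_cast
    constructor <;> ring

/-- The equation m(m+1) = M(M+1) holds only for m = M and m = -M-1: the multiplicity can change only
at the two ends of the weight string. -/
lemma casimir_value_ne {s : ℤ} (h1 : s ≠ max ((a : ℤ) - b) 0)
    (h2 : s + 1 ≠ min ((a : ℤ) - b) 0) :
    minSpin a b * (minSpin a b + 1) ≠
      ((s : ℝ) + (spin b - spin a)) * ((s : ℝ) + (spin b - spin a) + 1) := by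
  obtain ⟨hA, hB⟩ := minSpin_eq_max a b
  intro h
  have h3 : (minSpin a b - ((s : ℝ) + (spin b - spin a))) *
      (-minSpin a b - (((s + 1 : ℤ) : ℝ) + (spin b - spin a))) = 0 := by
    push_cast
    linear_combination -h
  rcases mul_eq_zero.1 h3 with h4 | h4
  · apply h1
    rw [hA] at h4
    have h5 : (s : ℝ) = ((max ((a : ℤ) - b) 0 : ℤ) : ℝ) := by linarith
    exact_mod_cast h5
  · apply h2
    rw [hB] at h4
    have h5 : ((s + 1 : ℤ) : ℝ) = ((min ((a : ℤ) - b) 0 : ℤ) : ℝ) := by linarith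
    exact_mod_cast h5

/-- The multiplicity is constant beyond the top, and `a + 1` steps further no basis vector has the
required degree. -/
lemma multiplicity_above {s : ℤ} (hs : max ((a : ℤ) - b) 0 < s) : multiplicity a b s = 0 := by
  have h : ∀ n : ℕ, multiplicity a b (s + n) = multiplicity a b s := by
    intro n
    induction n with
    | zero => simp
    | succ n ih =>
      rw [← ih, Nat.cast_succ, ← add_assoc]
      exact multiplicity_succ (casimir_value_ne (by omega) (by omega))
  rw [← h (a + 1)]
  apply multiplicity_eq_zero
  rintro ⟨i, p⟩
  simp only [degree]
  omega

lemma multiplicity_below {s : ℤ} (hs : s < min ((a : ℤ) - b) 0) : multiplicity a b s = 0 := by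
  have h : ∀ n : ℕ, multiplicity a b (s - n) = multiplicity a b s := by
    intro n
    induction n with
    | zero => simp
    | succ n ih =>
      rw [← ih]
      have := multiplicity_succ (a := a) (b := b) (s := s - (n + 1 : ℕ))
        (casimir_value_ne (by omega) (by omega))
      rw [← this]
      congr 1
      push_cast
      ring
  rw [← h (b + 1)]
  apply multiplicity_eq_zero
  rintro ⟨i, p⟩
  simp only [degree]
  omega

lemma multiplicity_between {s : ℤ} (hs : min ((a : ℤ) - b) 0 ≤ s)
    (hs' : s ≤ max ((a : ℤ) - b) 0) : multiplicity a b s = 1 := by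
  have h : ∀ n : ℕ, min ((a : ℤ) - b) 0 ≤ max ((a : ℤ) - b) 0 - n →
      multiplicity a b (max ((a : ℤ) - b) 0 - n) = 1 := by
    intro n
    induction n with
    | zero =>
      intro _
      rw [← multiplicity_top a b]
      congr 1
      omega
    | succ n ih =>
      intro hn
      rw [← ih (by omega)]
      have := multiplicity_succ (a := a) (b := b) (s := max ((a : ℤ) - b) 0 - (n + 1 : ℕ))
        (casimir_value_ne (by omega) (by omega))
      rw [← this]
      congr 1
      push_cast
      ring
  have h1 := h (max ((a : ℤ) - b) 0 - s).toNat (by omega)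
  rwa [Int.toNat_of_nonneg (by omega), sub_sub_cancel] at h1

/-- The subspace of smallest total angular momentum `L` has dimension `2 L + 1`. -/
lemma trace_projection (a b : ℕ) :
    (totalSpinProjection a b (minSpin a b)).trace = ((2 * minSpin a b + 1 : ℝ) : ℂ) := by
  have hone : ∑ s ∈ Finset.Icc (-(b : ℤ)) a, weightProjection a b s = 1 := by
    ext x y
    rw [Matrix.sum_apply]
    simp only [weightProjection, diagonal_apply, one_apply]
    by_cases h : x = y
    · subst h
      have : degree x ∈ Finset.Icc (-(b : ℤ)) a := by
        rw [Finset.mem_Icc]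
        simp only [degree]
        omega
      simp [Finset.sum_ite_eq, this]
    · simp [h]
  have h1 : (totalSpinProjection a b (minSpin a b)).trace =
      ∑ s ∈ Finset.Icc (-(b : ℤ)) a, multiplicity a b s := by
    simp only [multiplicity]
    rw [← trace_sum, ← Finset.mul_sum, hone, mul_one]
  have hsub : Finset.Icc (min ((a : ℤ) - b) 0) (max ((a : ℤ) - b) 0) ⊆
      Finset.Icc (-(b : ℤ)) a := by
    intro s
    simp only [Finset.mem_Icc]
    omega
  rw [h1, ← Finset.sum_subset hsub, Finset.sum_congr rfl fun s hs =>
    multiplicity_between (Finset.mem_Icc.1 hs).1 (Finset.mem_Icc.1 hs).2]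
  · obtain ⟨hA, hB⟩ := minSpin_eq_max a b
    rw [Finset.sum_const, Int.card_Icc, nsmul_one]
    have h2 : ((max ((a : ℤ) - b) 0 + 1 - min ((a : ℤ) - b) 0).toNat : ℤ) =
      max ((a : ℤ) - b) 0 + 1 - min ((a : ℤ) - b) 0 := Int.toNat_of_nonneg (by omega)
    have h3 : ((max ((a : ℤ) - b) 0 + 1 - min ((a : ℤ) - b) 0).toNat : ℝ) =
        2 * minSpin a b + 1 := by
      have h4 : ((max ((a : ℤ) - b) 0 + 1 - min ((a : ℤ) - b) 0).toNat : ℝ) =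
        ((max ((a : ℤ) - b) 0 + 1 - min ((a : ℤ) - b) 0 : ℤ) : ℝ) := by exact_mod_cast h2
      rw [h4, Int.cast_sub, Int.cast_add, Int.cast_one]
      linarith
    rw [← h3]
    push_cast
    rfl
  · intro s _ hs
    rw [Finset.mem_Icc, not_and_or, not_le, not_le] at hs
    rcases hs with hs | hs
    · exact multiplicity_below hs
    · exact multiplicity_above hs

/-! ### Choi matrices and complete positivity. -/

/-- The Choi matrix `∑ Φ(|p⟩⟨q|) ⊗ |p⟩⟨q|`. -/
noncomputable def choi (Φ : Op a →ₗ[ℂ] Op b) :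
    Matrix (Fin (b + 1) × Fin (a + 1)) (Fin (b + 1) × Fin (a + 1)) ℂ :=
  Matrix.of fun x y => Φ (single x.2 y.2 1) x.1 y.1

lemma map_eq_sum_single (Φ : Op a →ₗ[ℂ] Op b) (X : Op a) :
    Φ X = ∑ p, ∑ q, X p q • Φ (single p q 1) := by
  conv_lhs => rw [matrix_eq_sum_single X]
  simp only [map_sum]
  refine Finset.sum_congr rfl fun p _ => Finset.sum_congr rfl fun q _ => ?_
  rw [← map_smul, smul_single, smul_eq_mul, mul_one]

lemma map_apply_eq_sum_choi (Φ : Op a →ₗ[ℂ] Op b) (X : Op a) (i j : Fin (b + 1)) :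
    Φ X i j = ∑ p, ∑ q, choi Φ (i, p) (j, q) * X p q := by
  rw [map_eq_sum_single]
  simp only [Matrix.sum_apply, Matrix.smul_apply, smul_eq_mul, choi, of_apply]
  exact Finset.sum_congr rfl fun p _ => Finset.sum_congr rfl fun q _ => mul_comm _ _

lemma choi_injective : Function.Injective (choi : (Op a →ₗ[ℂ] Op b) → _) := by
  intro Φ Ψ h
  ext X i j
  rw [map_apply_eq_sum_choi, map_apply_eq_sum_choi, h]

lemma choi_ofJamiolkowski
    (𝒥 : Matrix (Fin (b + 1) × Fin (a + 1)) (Fin (b + 1) × Fin (a + 1)) ℂ) :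
    choi (ofJamiolkowski 𝒥) = ((a : ℂ) + 1) • 𝒥 := by
  ext ⟨i, p⟩ ⟨j, q⟩
  simp [choi, ofJamiolkowski, single_apply, ite_and]

lemma choi_add_smul (s t : ℝ) (Φ Ψ : Op a →ₗ[ℂ] Op b) :
    choi (s • Φ + t • Ψ) = s • choi Φ + t • choi Ψ := by
  ext x y
  simp [choi]

lemma choi_posSemidef {Φ : Op a →ₗ[ℂ] Op b} (hΦ : IsChannel Φ) : (choi Φ).PosSemidef := by
  -- The unnormalised maximally entangled vector; Φ ⊗ id sends its rank-one operator to the Choi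
  -- matrix.
  let e : Fin (a + 1) × Fin (a + 1) → ℂ := fun x => if x.1 = x.2 then 1 else 0
  have h := hΦ.completelyPositive (a + 1) _ (posSemidef_vecMulVec_self_star e)
  convert h using 1
  ext x y
  simp only [choi, ampliation, of_apply]
  refine congrFun (congrFun (congrArg Φ ?_) x.1) y.1
  ext i j
  simp only [vecMulVec_apply, e, single_apply, Pi.star_apply]
  by_cases h1 : i = x.2 <;> by_cases h2 : j = y.2 <;> simp [h1, h2, eq_comm]

lemma trace_choi {Φ : Op a →ₗ[ℂ] Op b} (hΦ : IsChannel Φ) : (choi Φ).trace = (a : ℂ) + 1 := by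
  have h : ∀ p, ∑ i, choi Φ (i, p) (i, p) = 1 := by
    intro p
    have h1 := hΦ.tracePreserving (single p p 1)
    rw [trace_single_eq_same] at h1
    exact h1
  rw [trace, Fintype.sum_prod_type_right]
  simp only [diag_apply, h]
  simp

/-- A positive semidefinite Jamiołkowski operator gives a completely positive map. -/
lemma ofJamiolkowski_completelyPositive
    {𝒥 : Matrix (Fin (b + 1) × Fin (a + 1)) (Fin (b + 1) × Fin (a + 1)) ℂ} (h𝒥 : 𝒥.PosSemidef)
    (k : ℕ) {M : Matrix (Fin (a + 1) × Fin k) (Fin (a + 1) × Fin k) ℂ} (hM : M.PosSemidef) :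
    (ampliation (ofJamiolkowski 𝒥) k M).PosSemidef := by
  -- `S` contracts the two copies of H_A along the diagonal, so the ampliation is, up to the factor
  -- `a + 1`, a congruence transform of `𝒥 ⊗ M`.
  let S : Matrix (Fin (b + 1) × Fin k) ((Fin (b + 1) × Fin (a + 1)) × (Fin (a + 1) × Fin k)) ℂ :=
    Matrix.of fun x y => if x.1 = y.1.1 ∧ x.2 = y.2.2 ∧ y.1.2 = y.2.1 then 1 else 0
  have h : ampliation (ofJamiolkowski 𝒥) k M = ((a : ℂ) + 1) • (S * (𝒥 ⊗ₖ M) * Sᴴ) := by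
    ext ⟨i, r⟩ ⟨j, s⟩
    simp [S, ampliation, ofJamiolkowski, mul_apply, Fintype.sum_prod_type, ite_and,
      apply_ite (starRingEnd ℂ)]
    exact Or.inl Finset.sum_comm
  rw [h]
  refine ((h𝒥.kronecker hM).mul_mul_conjTranspose_same S).smul ?_
  exact_mod_cast (Nat.cast_nonneg (α := ℂ) (a + 1))

/-! ### Infinitesimal covariance and the Heisenberg picture. -/

/-- `Φ` intertwines the commutator with `A` and the commutator with `B`. -/
def Intertwines (Φ : Op a →ₗ[ℂ] Op b) (A : Op a) (B : Op b) : Prop :=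
  ∀ X, Φ (A * X - X * A) = B * Φ X - Φ X * B

lemma Intertwines.add {Φ : Op a →ₗ[ℂ] Op b} {A A' : Op a} {B B' : Op b}
    (h : Intertwines Φ A B) (h' : Intertwines Φ A' B') : Intertwines Φ (A + A') (B + B') := by
  intro X
  have : (A + A') * X - X * (A + A') = (A * X - X * A) + (A' * X - X * A') := by noncomm_ring
  rw [this, map_add, h, h']
  noncomm_ring

lemma Intertwines.smul {Φ : Op a →ₗ[ℂ] Op b} {A : Op a} {B : Op b}
    (h : Intertwines Φ A B) (c : ℂ) : Intertwines Φ (c • A) (c • B) := by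
  intro X
  rw [smul_mul_assoc, mul_smul_comm, ← smul_sub, map_smul, h, smul_mul_assoc, mul_smul_comm,
    smul_sub]

lemma tensorGenerator_commutator_choi (Φ : Op a →ₗ[ℂ] Op b) (A : Op a) (B : Op b)
    (i j : Fin (b + 1)) (p q : Fin (a + 1)) :
    (tensorGenerator B A * choi Φ - choi Φ * tensorGenerator B A) (i, p) (j, q) =
      (B * Φ (single p q 1) - Φ (single p q 1) * B -
        Φ (A * single p q 1 - single p q 1 * A)) i j := by
  have h1 : (tensorGenerator B A * choi Φ) (i, p) (j, q) =
      (B * Φ (single p q 1)) i j - Φ (A * single p q 1) i j := by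
    have h := tensorGenerator_mulVec_apply B A (fun x => choi Φ x (j, q)) i p
    rw [map_apply_eq_sum_choi Φ (A * single p q 1)]
    refine Eq.trans h ?_
    congr 1
    refine Finset.sum_congr rfl fun p' _ => ?_
    simp [mul_apply, single_apply, ite_and, mul_comm]
  have h2 : (choi Φ * tensorGenerator B A) (i, p) (j, q) =
      (Φ (single p q 1) * B) i j - Φ (single p q 1 * A) i j := by
    rw [map_apply_eq_sum_choi Φ (single p q 1 * A)]
    rw [tensorGenerator, mul_sub, Matrix.sub_apply]
    congr 1
    · simp [mul_apply, Fintype.sum_prod_type, one_apply, choi]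
    · simp [mul_apply, Fintype.sum_prod_type, one_apply, single_apply, ite_and]
  rw [Matrix.sub_apply, h1, h2, map_sub]
  simp only [Matrix.sub_apply]
  ring

/-- On matrix units the intertwining relation is, entry by entry, the commutator with the Choi
matrix; linearity does the rest. -/
lemma intertwines_iff_commute {Φ : Op a →ₗ[ℂ] Op b} {A : Op a} {B : Op b} :
    Intertwines Φ A B ↔ Commute (tensorGenerator B A) (choi Φ) := by
  constructor
  · intro h
    change _ * _ = _ * _
    rw [← sub_eq_zero]
    ext ⟨i, p⟩ ⟨j, q⟩
    rw [tensorGenerator_commutator_choi, h, sub_self]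
    rfl
  · intro h X
    have h1 : ∀ p q, Φ (A * single p q 1 - single p q 1 * A) =
        B * Φ (single p q 1) - Φ (single p q 1) * B := by
      intro p q
      ext i j
      have h2 := tensorGenerator_commutator_choi Φ A B i j p q
      rw [h.eq, sub_self, Matrix.zero_apply, Matrix.sub_apply] at h2
      exact (sub_eq_zero.1 h2.symm).symm
    conv_lhs => rw [matrix_eq_sum_single X]
    rw [map_eq_sum_single Φ X]
    simp only [Finset.mul_sum, Finset.sum_mul, ← Finset.sum_sub_distrib, map_sum]
    refine Finset.sum_congr rfl fun p _ => Finset.sum_congr rfl fun q _ => ?_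
    have h3 : single p q (X p q) = X p q • (single p q 1 : Op a) := by
      rw [smul_single, smul_eq_mul, mul_one]
    rw [h3, mul_smul_comm, smul_mul_assoc, ← smul_sub, map_smul, h1, mul_smul_comm,
      smul_mul_assoc, smul_sub]

/-- The adjoint of `Φ` for the trace pairing (the Heisenberg picture). -/
noncomputable def dual (Φ : Op a →ₗ[ℂ] Op b) (Y : Op b) : Op a :=
  Matrix.of fun q p => (Y * Φ (single p q 1)).trace

lemma trace_dual_mul (Φ : Op a →ₗ[ℂ] Op b) (Y : Op b) (X : Op a) :
    (dual Φ Y * X).trace = (Y * Φ X).trace := by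
  rw [map_eq_sum_single Φ X]
  simp only [Finset.mul_sum, trace_sum, mul_smul_comm, trace_smul, smul_eq_mul]
  rw [trace, Finset.sum_comm]
  refine Finset.sum_congr rfl fun q _ => ?_
  rw [diag_apply, mul_apply]
  exact Finset.sum_congr rfl fun p _ => by rw [dual, of_apply, mul_comm]

lemma eq_dual_of_trace {Φ : Op a →ₗ[ℂ] Op b} {Y : Op b} {Z : Op a}
    (h : ∀ X, (Z * X).trace = (Y * Φ X).trace) : dual Φ Y = Z := by
  rw [ext_iff_trace_mul_right]
  intro X
  rw [trace_dual_mul, h]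

lemma dual_smul (Φ : Op a →ₗ[ℂ] Op b) (c : ℂ) (Y : Op b) :
    dual Φ (c • Y) = c • dual Φ Y := by
  ext; simp [dual]

lemma dual_add (Φ : Op a →ₗ[ℂ] Op b) (Y Y' : Op b) :
    dual Φ (Y + Y') = dual Φ Y + dual Φ Y' := by
  ext; simp [dual, add_mul]

/-- Taking commutators is antisymmetric for the trace pairing, on both sides, so the two signs
cancel. -/
lemma Intertwines.dual_commutator {Φ : Op a →ₗ[ℂ] Op b} {A : Op a} {B : Op b}
    (h : Intertwines Φ A B) (Y : Op b) :
    A * dual Φ Y - dual Φ Y * A = dual Φ (B * Y - Y * B) := by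
  refine (eq_dual_of_trace fun X => ?_).symm
  have h1 : ((A * dual Φ Y - dual Φ Y * A) * X).trace = -(dual Φ Y * (A * X - X * A)).trace := by
    simp only [sub_mul, mul_sub, trace_sub]
    rw [mul_assoc A, trace_mul_comm A, mul_assoc, mul_assoc]
    ring
  rw [h1, trace_dual_mul, h]
  simp only [sub_mul, mul_sub, trace_sub]
  rw [mul_assoc B, trace_mul_comm B, mul_assoc, mul_assoc]
  ring

/-- Covariance under the Lie algebra. -/
def IsInfinitesimallyCovariant (Φ : Op a →ₗ[ℂ] Op b) : Prop :=
  ∀ k, Intertwines Φ (spinOp a k) (spinOp b k)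

lemma spinRaise_eq (n : ℕ) : spinRaise n = spinOp n 0 + Complex.I • spinOp n 1 := by
  rw [spinOp_zero, spinOp_one, smul_smul]
  have : Complex.I * (-Complex.I / 2) = 1 / 2 := by
    linear_combination (-1 / 2 : ℂ) * Complex.I_mul_I
  rw [this]
  module

lemma conjTranspose_spinRaise_eq (n : ℕ) :
    (spinRaise n)ᴴ = spinOp n 0 + (-Complex.I) • spinOp n 1 := by
  rw [spinRaise_eq, conjTranspose_add, conjTranspose_smul, (spinOp_isHermitian n 0).eq,
    (spinOp_isHermitian n 1).eq]
  simp

namespace IsInfinitesimallyCovariant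

variable {Φ : Op a →ₗ[ℂ] Op b}

lemma raise (h : IsInfinitesimallyCovariant Φ) : Intertwines Φ (spinRaise a) (spinRaise b) := by
  rw [spinRaise_eq, spinRaise_eq]
  exact (h 0).add ((h 1).smul _)

lemma lower (h : IsInfinitesimallyCovariant Φ) :
    Intertwines Φ (spinRaise a)ᴴ (spinRaise b)ᴴ := by
  rw [conjTranspose_spinRaise_eq, conjTranspose_spinRaise_eq]
  exact (h 0).add ((h 1).smul _)

/-- The Heisenberg-picture image of the identity is scalar. -/
lemma dual_one (h : IsInfinitesimallyCovariant Φ) : ∃ c : ℂ, dual Φ 1 = c • 1 := by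
  have key : ∀ {A : Op a} {B : Op b}, Intertwines Φ A B → Commute A (dual Φ 1) := by
    intro A B hAB
    have h1 := hAB.dual_commutator 1
    rw [mul_one, one_mul, sub_self] at h1
    have h2 : dual Φ 0 = 0 := by ext; simp [dual]
    exact sub_eq_zero.1 (h1.trans h2)
  exact ⟨_, eq_smul_one_of_commute (key (h 2)) (key h.raise)⟩

/-- The Heisenberg-picture images of the spin operators are proportional to spin operators. -/
lemma dual_spinOp (ha : 0 < a) (h : IsInfinitesimallyCovariant Φ) :
    ∃ κ : ℂ, ∀ k, dual Φ (spinOp b k) = κ • spinOp a k := by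
  have h2 : dual Φ 0 = 0 := by ext; simp [dual]
  obtain ⟨κ, hκ⟩ : ∃ κ : ℂ, dual Φ (spinRaise b) = κ • spinRaise a := by
    apply eq_smul_spinRaise ha
    · rw [(h 2).dual_commutator, spinOp_two_commutator]
    · have h1 := h.raise.dual_commutator (spinRaise b)
      rw [sub_self, h2] at h1
      exact sub_eq_zero.1 h1
  -- The remaining components come from lowering, by [J₋, J₊] = -2 J_z and [J₋, J_z] = J₋, so the
  -- same κ appears in all of them.
  have hz : dual Φ (spinOp b 2) = κ • spinOp a 2 := by
    have h1 := h.lower.dual_commutator (spinRaise b)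
    have h3 : ∀ n, (spinRaise n)ᴴ * spinRaise n - spinRaise n * (spinRaise n)ᴴ =
        (-2 : ℂ) • spinOp n 2 := by
      intro n
      rw [← neg_sub, spinRaise_commutator, neg_smul]
    rw [hκ, mul_smul_comm, smul_mul_assoc, ← smul_sub, h3, h3, dual_smul, smul_comm] at h1
    exact (smul_right_injective _ (by norm_num : (-2 : ℂ) ≠ 0) h1).symm
  have hm : dual Φ (spinRaise b)ᴴ = κ • (spinRaise a)ᴴ := by
    have h1 := h.lower.dual_commutator (spinOp b 2)
    have h3 : ∀ n, (spinRaise n)ᴴ * spinOp n 2 - spinOp n 2 * (spinRaise n)ᴴ =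
        (spinRaise n)ᴴ := by
      intro n
      have h4 := congrArg conjTranspose (spinOp_two_commutator n)
      rwa [conjTranspose_sub, conjTranspose_mul, conjTranspose_mul,
        (spinOp_isHermitian n 2).eq] at h4
    rw [hz, mul_smul_comm, smul_mul_assoc, ← smul_sub, h3, h3] at h1
    exact h1.symm
  refine ⟨κ, fun k => ?_⟩
  fin_cases k
  · change dual Φ (spinOp b 0) = κ • spinOp a 0
    rw [spinOp_zero, spinOp_zero, dual_smul, dual_add, hκ, hm, ← smul_add, smul_comm]
  · change dual Φ (spinOp b 1) = κ • spinOp a 1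
    rw [spinOp_one, spinOp_one, dual_smul, sub_eq_add_neg, ← neg_one_smul ℂ (spinRaise b)ᴴ,
      dual_add, dual_smul, hκ, hm]
    module
  · exact hz

end IsInfinitesimallyCovariant

/-! ### Passing between the Lie algebra and the rotations. -/

section Conjugation

variable {𝔸 : Type*} [NormedRing 𝔸] [NormedAlgebra ℝ 𝔸] [CompleteSpace 𝔸]

lemma hasDerivAt_exp_conj (H X : 𝔸) (t : ℝ) :
    HasDerivAt (fun u : ℝ => NormedSpace.exp (u • H) * X * NormedSpace.exp (u • -H))
      (H * (NormedSpace.exp (t • H) * X * NormedSpace.exp (t • -H)) -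
        NormedSpace.exp (t • H) * X * NormedSpace.exp (t • -H) * H) t := by
  have h := ((hasDerivAt_exp_smul_const' (𝕂 := ℝ) H t).mul_const X).mul
    (hasDerivAt_exp_smul_const (𝕂 := ℝ) (-H) t)
  refine h.congr_deriv ?_
  generalize NormedSpace.exp (t • -H) = U
  noncomm_ring

variable {𝔹 : Type*} [NormedRing 𝔹] [NormedAlgebra ℝ 𝔹] [CompleteSpace 𝔹]

/-- A continuous linear map that intertwines two commutators intertwines the conjugations by
the one-parameter groups that they generate. -/
lemma map_exp_conj (Φ : 𝔸 →L[ℝ] 𝔹) {A : 𝔸} {B : 𝔹}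
    (h : ∀ X, Φ (A * X - X * A) = B * Φ X - Φ X * B) (X : 𝔸) :
    Φ (NormedSpace.exp A * X * NormedSpace.exp (-A)) =
      NormedSpace.exp B * Φ X * NormedSpace.exp (-B) := by
  let G : ℝ → 𝔹 := fun t => Φ (NormedSpace.exp (t • A) * X * NormedSpace.exp (t • -A))
  -- Undoing the conjugation by `exp (t • B)` reduces the claim to `F` being constant.
  let F : ℝ → 𝔹 := fun t => NormedSpace.exp (t • -B) * G t * NormedSpace.exp (t • B)
  have hG : ∀ t, HasDerivAt G (B * G t - G t * B) t := by
    intro t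
    have h1 := Φ.hasFDerivAt.comp_hasDerivAt t (hasDerivAt_exp_conj A X t)
    rwa [h] at h1
  have hF : ∀ t, HasDerivAt F 0 t := by
    intro t
    have h1 := ((hasDerivAt_exp_smul_const (𝕂 := ℝ) (-B) t).mul (hG t)).mul
      (hasDerivAt_exp_smul_const' (𝕂 := ℝ) B t)
    refine h1.congr_deriv ?_
    simp only [Pi.mul_apply]
    generalize NormedSpace.exp (t • -B) = U
    noncomm_ring
  have h1 : F 1 = F 0 :=
    is_const_of_deriv_eq_zero (fun t => (hF t).differentiableAt) (fun t => (hF t).deriv) 1 0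
  simp only [F, G, one_smul, zero_smul, NormedSpace.exp_zero, mul_one, one_mul] at h1
  have h2 : NormedSpace.exp B * NormedSpace.exp (-B) = 1 := by
    rw [← NormedSpace.exp_add_of_commute_of_mem_ball (𝕂 := ℝ) (Commute.neg_right (Commute.refl B))
      ((NormedSpace.expSeries_radius_eq_top ℝ 𝔹).symm ▸ edist_lt_top _ _)
      ((NormedSpace.expSeries_radius_eq_top ℝ 𝔹).symm ▸ edist_lt_top _ _), add_neg_cancel,
      NormedSpace.exp_zero]
  rw [← h1]
  calc Φ (NormedSpace.exp A * X * NormedSpace.exp (-A))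
      = (NormedSpace.exp B * NormedSpace.exp (-B)) *
          Φ (NormedSpace.exp A * X * NormedSpace.exp (-A)) *
          (NormedSpace.exp B * NormedSpace.exp (-B)) := by rw [h2, one_mul, mul_one]
    _ = _ := by noncomm_ring

/-- A continuous linear map that intertwines the conjugations by two one-parameter groups
intertwines the commutators with their generators. -/
lemma map_commutator (Φ : 𝔸 →L[ℝ] 𝔹) {A : 𝔸} {B : 𝔹} {X : 𝔸}
    (h : ∀ t : ℝ, Φ (NormedSpace.exp (t • A) * X * NormedSpace.exp (t • -A)) =
      NormedSpace.exp (t • B) * Φ X * NormedSpace.exp (t • -B)) :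
    Φ (A * X - X * A) = B * Φ X - Φ X * B := by
  have h1 := Φ.hasFDerivAt.comp_hasDerivAt (0 : ℝ) (hasDerivAt_exp_conj A X 0)
  have h2 := hasDerivAt_exp_conj B (Φ X) 0
  have h3 := (h1.congr_of_eventuallyEq (Filter.Eventually.of_forall fun t => (h t).symm)).unique h2
  simpa using h3

end Conjugation

/-- The generator of the rotation by `g`. -/
noncomputable def rotationGenerator (n : ℕ) (g : Fin 3 → ℝ) : Op n :=
  Complex.I • ∑ k, ((g k : ℝ) : ℂ) • spinOp n k

lemma rotation_eq (n : ℕ) (g : Fin 3 → ℝ) :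
    rotation n g = NormedSpace.exp (rotationGenerator n g) := rfl

lemma rotationGenerator_conjTranspose (n : ℕ) (g : Fin 3 → ℝ) :
    (rotationGenerator n g)ᴴ = -rotationGenerator n g := by
  simp [rotationGenerator, conjTranspose_smul, conjTranspose_sum, (spinOp_isHermitian n _).eq]

lemma rotation_conjTranspose (n : ℕ) (g : Fin 3 → ℝ) :
    (rotation n g)ᴴ = NormedSpace.exp (-rotationGenerator n g) := by
  rw [rotation_eq, ← Matrix.exp_conjTranspose, rotationGenerator_conjTranspose]

lemma rotationGenerator_single (n : ℕ) (k : Fin 3) (t : ℝ) :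
    rotationGenerator n (Pi.single k t) = t • (Complex.I • spinOp n k) := by
  rw [rotationGenerator, Finset.sum_eq_single k]
  · rw [Pi.single_eq_same, smul_comm]
    rfl
  · intro l _ hl
    rw [Pi.single_eq_of_ne hl, Complex.ofReal_zero, zero_smul]
  · simp

section Norms

attribute [local instance] Matrix.linftyOpNormedRing Matrix.linftyOpNormedAlgebra

lemma IsInfinitesimallyCovariant.isCovariant {Φ : Op a →ₗ[ℂ] Op b}
    (h : IsInfinitesimallyCovariant Φ) : IsCovariant Φ := by
  intro g X
  rw [rotation_conjTranspose, rotation_conjTranspose, rotation_eq, rotation_eq]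
  have hint : Intertwines Φ (rotationGenerator a g) (rotationGenerator b g) := by
    simp only [rotationGenerator, Fin.sum_univ_three]
    exact ((((h 0).smul _).add ((h 1).smul _)).add ((h 2).smul _)).smul _
  exact map_exp_conj (LinearMap.toContinuousLinearMap (Φ.restrictScalars ℝ)) hint X

/-- Rotations about a single axis form a one-parameter group, which is differentiated at `t = 0`. -/
lemma IsCovariant.isInfinitesimallyCovariant {Φ : Op a →ₗ[ℂ] Op b} (h : IsCovariant Φ) :
    IsInfinitesimallyCovariant Φ := by
  intro k
  have h1 : Intertwines Φ (Complex.I • spinOp a k) (Complex.I • spinOp b k) := by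
    intro X
    refine map_commutator (LinearMap.toContinuousLinearMap (Φ.restrictScalars ℝ)) fun t => ?_
    have h2 := h (Pi.single k t) X
    rw [rotation_conjTranspose, rotation_conjTranspose, rotation_eq, rotation_eq,
      rotationGenerator_single, rotationGenerator_single, ← smul_neg t (Complex.I • spinOp a k),
      ← smul_neg t (Complex.I • spinOp b k)] at h2
    exact h2
  have h2 := h1.smul (-Complex.I)
  simpa [smul_smul] using h2

end Norms

/-! ### The scaling factor and its upper bound. -/

/-- An operator with vanishing expectation in every state vanishes. -/
lemma eq_zero_of_trace_state {n : ℕ} {D : Op n} (h : ∀ ρ, IsState ρ → (D * ρ).trace = 0) :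
    D = 0 := by
  have hv : ∀ v : Fin (n + 1) → ℂ, star v ⬝ᵥ (D *ᵥ v) = 0 := by
    intro v
    have htr : star v ⬝ᵥ (D *ᵥ v) = (D * vecMulVec v (star v)).trace := by
      rw [mul_vecMulVec, trace_vecMulVec, dotProduct_comm]
    by_cases hv0 : v = 0
    · simp [hv0]
    have hpos : 0 < star v ⬝ᵥ v := dotProduct_star_self_pos_iff.2 hv0
    have hstate : IsState ((star v ⬝ᵥ v)⁻¹ • vecMulVec v (star v)) := by
      refine ⟨(posSemidef_vecMulVec_self_star v).smul (inv_nonneg.2 hpos.le), ?_⟩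
      rw [trace_smul, trace_vecMulVec, dotProduct_comm v, smul_eq_mul, inv_mul_cancel₀ hpos.ne']
    have h1 := h _ hstate
    rw [mul_smul_comm, trace_smul, smul_eq_mul] at h1
    rw [htr]
    exact (mul_eq_zero.1 h1).resolve_left (inv_ne_zero hpos.ne')
  -- Over ℂ a vanishing quadratic form forces the operator to vanish, Hermitian or not.
  have h1 : Matrix.toEuclideanLin D = 0 := by
    rw [← inner_map_self_eq_zero]
    intro x
    rw [← inner_conj_symm, EuclideanSpace.inner_eq_star_dotProduct, dotProduct_comm]
    have h2 := hv x.ofLp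
    rw [map_eq_zero]
    exact h2
  exact (LinearEquiv.map_eq_zero_iff _).1 h1

/-- Expectations in all states separate operators, which moves the condition from states to the
adjoint map. -/
lemma scalesPolarisation_iff {Φ : Op a →ₗ[ℂ] Op b} {κ : ℝ} :
    ScalesPolarisation Φ κ ↔ ∀ k, dual Φ (spinOp b k) = (κ : ℂ) • spinOp a k := by
  constructor
  · intro h k
    rw [← sub_eq_zero]
    apply eq_zero_of_trace_state
    intro ρ hρ
    have h1 := h ρ hρ k
    simp only [polarisation] at h1
    rw [sub_mul, trace_sub, trace_dual_mul, h1, smul_mul_assoc, trace_smul, smul_eq_mul, sub_self]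
  · intro h ρ _ k
    simp only [polarisation]
    rw [← trace_dual_mul, h, smul_mul_assoc, trace_smul, smul_eq_mul]

lemma scalesPolarisation_unique (ha : 0 < a) {Φ : Op a →ₗ[ℂ] Op b} {κ κ' : ℝ}
    (h : ScalesPolarisation Φ κ) (h' : ScalesPolarisation Φ κ') : κ = κ' := by
  rw [scalesPolarisation_iff] at h h'
  -- The corner entry of J_A^z is j_A, which is nonzero.
  have h1 := congrFun (congrFun ((h 2).symm.trans (h' 2)) 0) 0
  simp only [Matrix.smul_apply, spinOp_two, diagonal_apply_eq, smul_eq_mul] at h1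
  have h2 : ((magnetic a 0 : ℝ) : ℂ) ≠ 0 := by
    simp [magnetic, spin, ha.ne']
  exact_mod_cast mul_right_cancel₀ h2 h1

lemma trace_kronecker_mul_choi (Φ : Op a →ₗ[ℂ] Op b) (Y : Op b) (X : Op a) :
    ((Y ⊗ₖ Xᵀ) * choi Φ).trace = (Y * Φ X).trace := by
  simp only [trace, diag_apply, mul_apply, Fintype.sum_prod_type, kroneckerMap_apply,
    transpose_apply, map_apply_eq_sum_choi Φ X, Finset.mul_sum]
  refine Finset.sum_congr rfl fun i _ => ?_
  rw [Finset.sum_comm]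
  refine Finset.sum_congr rfl fun j _ => ?_
  rw [Finset.sum_comm]
  refine Finset.sum_congr rfl fun q _ => Finset.sum_congr rfl fun p _ => ?_
  ring

lemma trace_choi_eq (Φ : Op a →ₗ[ℂ] Op b) : (choi Φ).trace = (Φ 1).trace := by
  have h := trace_kronecker_mul_choi Φ 1 1
  rwa [transpose_one, one_kronecker_one, one_mul, one_mul] at h

/-- The mean squared total angular momentum of the Jamiołkowski operator determines the scaling
factor. -/
lemma trace_casimir_mul_choi {Φ : Op a →ₗ[ℂ] Op b} {κ : ℂ}
    (hκ : ∀ k, dual Φ (spinOp b k) = κ • spinOp a k) (htr : (choi Φ).trace = (a : ℂ) + 1) :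
    (casimir a b * choi Φ).trace = ((a : ℂ) + 1) *
      (((spin b * (spin b + 1) + spin a * (spin a + 1) : ℝ) : ℂ) -
        ((2 * (spin a * (spin a + 1)) : ℝ) : ℂ) * κ) := by
  have h1 : ((∑ k, spinOp b k ⊗ₖ (spinOp a k)ᵀ) * choi Φ).trace =
      κ * (((spin a * (spin a + 1) : ℝ) : ℂ) * ((a : ℂ) + 1)) := by
    rw [Finset.sum_mul, trace_sum]
    simp only [trace_kronecker_mul_choi, ← trace_dual_mul, hκ, smul_mul_assoc, trace_smul]
    rw [← Finset.smul_sum, ← trace_sum, sum_spinOp_sq, trace_smul, trace_one]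
    simp
  rw [casimir_eq_coupling, sub_mul, smul_mul_assoc, one_mul, smul_mul_assoc, trace_sub,
    trace_smul, trace_smul, h1, htr, smul_eq_mul, smul_eq_mul]
  push_cast
  ring

/-- This identifies κ₊ as the solution of the relation in `trace_casimir_mul_choi` when the Casimir
takes its minimal value. -/
lemma amplificationFactor_mul (ha : 0 < a) :
    amplificationFactor (spin a) (spin b) * (2 * (spin a * (spin a + 1))) =
      spin b * (spin b + 1) + spin a * (spin a + 1) - minSpin a b * (minSpin a b + 1) := by
  have h0 : 0 < spin a := by
    have : (0 : ℝ) < a := by exact_mod_cast ha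
    simp only [spin]
    linarith
  rw [amplificationFactor, minSpin]
  split_ifs with h
  · rw [abs_of_nonneg (by linarith)]
    field_simp
    ring
  · rw [abs_of_nonpos (by linarith)]
    field_simp
    ring

lemma spin_mul_pos (ha : 0 < a) : 0 < 2 * (spin a * (spin a + 1)) := by
  have : (0 : ℝ) < a := by exact_mod_cast ha
  simp only [spin]
  positivity

open scoped MatrixOrder Matrix.Norms.L2Operator in
lemma trace_mul_nonneg {ι : Type*} [Fintype ι] [DecidableEq ι] {M N : Matrix ι ι ℂ}
    (hM : M.PosSemidef) (hN : N.PosSemidef) : 0 ≤ (M * N).trace := by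
  obtain ⟨B, rfl⟩ := CStarAlgebra.nonneg_iff_eq_star_mul_self.1 hN.nonneg
  rw [star_eq_conjTranspose, ← mul_assoc, trace_mul_comm, ← mul_assoc]
  exact (hM.mul_mul_conjTranspose_same B).trace_nonneg

/-- No channel that scales the polarisation exceeds the amplification factor. -/
lemma scale_le_amplificationFactor (ha : 0 < a) {Φ : Op a →ₗ[ℂ] Op b} (hΦ : IsChannel Φ) {κ : ℝ}
    (hκ : ScalesPolarisation Φ κ) : κ ≤ amplificationFactor (spin a) (spin b) := by
  have h1 := trace_mul_nonneg (casimir_sub_posSemidef a b) (choi_posSemidef hΦ)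
  rw [sub_mul, trace_sub, trace_casimir_mul_choi (scalesPolarisation_iff.1 hκ) (trace_choi hΦ),
    smul_mul_assoc, one_mul, trace_smul, trace_choi hΦ, smul_eq_mul, mul_comm _ ((a : ℂ) + 1),
    ← mul_sub] at h1
  have h2 : (0 : ℝ) ≤ ((a : ℝ) + 1) * (spin b * (spin b + 1) + spin a * (spin a + 1) -
      2 * (spin a * (spin a + 1)) * κ - minSpin a b * (minSpin a b + 1)) := by
    exact_mod_cast h1
  have h3 := nonneg_of_mul_nonneg_right h2 (by positivity)
  have h4 := amplificationFactor_mul (b := b) ha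
  have h5 := spin_mul_pos ha
  refine le_of_mul_le_mul_right ?_ h5
  linarith

/-- The vector-operator argument gives a complex factor. It is real because the trace of a product
of two Hermitian matrices is real and here depends on κ affinely, with real coefficients and nonzero
slope. -/
lemma exists_scale (ha : 0 < a) {Φ : Op a →ₗ[ℂ] Op b} (hΦ : IsChannel Φ) (hcov : IsCovariant Φ) :
    ∃ κ : ℝ, ScalesPolarisation Φ κ := by
  obtain ⟨κ, hκ⟩ := hcov.isInfinitesimallyCovariant.dual_spinOp ha
  have h1 := trace_casimir_mul_choi hκ (trace_choi hΦ)
  have h2 : star (casimir a b * choi Φ).trace = (casimir a b * choi Φ).trace := by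
    rw [← trace_conjTranspose, conjTranspose_mul, (casimir_isHermitian a b).eq,
      (choi_posSemidef hΦ).isHermitian.eq, trace_mul_comm]
  have h3 : star κ = κ := by
    have ha0 : (a : ℂ) + 1 ≠ 0 := by exact_mod_cast Nat.succ_ne_zero a
    have hs : ((2 * (spin a * (spin a + 1)) : ℝ) : ℂ) ≠ 0 := by
      exact_mod_cast (spin_mul_pos ha).ne'
    rw [h1, star_mul', star_sub, star_mul'] at h2
    have e1 : star ((a : ℂ) + 1) = (a : ℂ) + 1 := by simp
    have e2 : ∀ r : ℝ, star (r : ℂ) = r := fun r => Complex.conj_ofReal r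
    rw [e1, e2, e2] at h2
    exact mul_left_cancel₀ hs (sub_right_injective (mul_left_cancel₀ ha0 h2))
  obtain ⟨r, hr⟩ := Complex.conj_eq_iff_real.1 h3
  exact ⟨r, scalesPolarisation_iff.2 fun k => by rw [hκ, hr]⟩

/-! ### The channel of smallest total spin. -/

lemma choi_extremalChannel (a b : ℕ) :
    choi (extremalChannel a b (minSpin a b)) = (((a : ℂ) + 1) *
      ((2 * minSpin a b + 1 : ℝ) : ℂ)⁻¹) • totalSpinProjection a b (minSpin a b) := by
  rw [extremalChannel, choi_ofJamiolkowski, smul_smul]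

lemma two_minSpin_ne_zero (a b : ℕ) : ((2 * minSpin a b + 1 : ℝ) : ℂ) ≠ 0 := by
  have := minSpin_nonneg a b
  exact_mod_cast (by positivity : (2 * minSpin a b + 1 : ℝ) ≠ 0)

lemma trace_choi_extremalChannel (a b : ℕ) :
    (choi (extremalChannel a b (minSpin a b))).trace = (a : ℂ) + 1 := by
  rw [choi_extremalChannel, trace_smul, trace_projection, smul_eq_mul, mul_assoc,
    inv_mul_cancel₀ (two_minSpin_ne_zero a b), mul_one]

lemma extremalChannel_isInfinitesimallyCovariant (a b : ℕ) :
    IsInfinitesimallyCovariant (extremalChannel a b (minSpin a b)) := by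
  intro k
  rw [intertwines_iff_commute, choi_extremalChannel, ← totalSpinOp_eq]
  exact (commute_projection_totalSpinOp k).symm.smul_right _

lemma extremalChannel_isChannel (a b : ℕ) : IsChannel (extremalChannel a b (minSpin a b)) where
  completelyPositive k M hM := by
    refine ofJamiolkowski_completelyPositive ?_ k hM
    refine (projection_posSemidef a b _).smul ?_
    rw [← Complex.ofReal_inv]
    have := minSpin_nonneg a b
    exact_mod_cast (by positivity : (0 : ℝ) ≤ (2 * minSpin a b + 1)⁻¹)
  tracePreserving X := by
    -- Schur's lemma makes `dual Φ 1` scalar, and the normalised trace of the Choi matrix shows that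
    -- the scalar is one.
    obtain ⟨c, hc⟩ := (extremalChannel_isInfinitesimallyCovariant a b).dual_one
    have ha0 : (a : ℂ) + 1 ≠ 0 := by exact_mod_cast Nat.succ_ne_zero a
    have h1 : c = 1 := by
      have h2 := trace_dual_mul (extremalChannel a b (minSpin a b)) 1 1
      rw [one_mul, ← trace_choi_eq, trace_choi_extremalChannel, hc, mul_one, trace_smul,
        trace_one, smul_eq_mul] at h2
      refine mul_right_cancel₀ ha0 ?_
      simpa using h2
    have h3 := trace_dual_mul (extremalChannel a b (minSpin a b)) 1 X
    rw [hc, h1, one_smul, one_mul, one_mul] at h3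
    exact h3.symm

lemma extremalChannel_mem (a b : ℕ) :
    extremalChannel a b (minSpin a b) ∈ covariantChannels a b :=
  ⟨extremalChannel_isChannel a b, (extremalChannel_isInfinitesimallyCovariant a b).isCovariant⟩

/-- The Casimir acts on the Choi matrix by its minimal value, so the bound on κ becomes an equality.
-/
lemma extremalChannel_scalesPolarisation (ha : 0 < a) (b : ℕ) :
    ScalesPolarisation (extremalChannel a b (minSpin a b))
      (amplificationFactor (spin a) (spin b)) := by
  obtain ⟨κ, hκ⟩ := exists_scale ha (extremalChannel_isChannel a b)
    (extremalChannel_isInfinitesimallyCovariant a b).isCovariant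
  have h1 := trace_casimir_mul_choi (scalesPolarisation_iff.1 hκ)
    (trace_choi_extremalChannel a b)
  have h2 : casimir a b * choi (extremalChannel a b (minSpin a b)) =
      ((minSpin a b * (minSpin a b + 1) : ℝ) : ℂ) • choi (extremalChannel a b (minSpin a b)) := by
    rw [choi_extremalChannel, mul_smul_comm, casimir_mul_projection, smul_comm]
  rw [h2, trace_smul, trace_choi_extremalChannel, smul_eq_mul, mul_comm] at h1
  have ha0 : (a : ℂ) + 1 ≠ 0 := by exact_mod_cast Nat.succ_ne_zero a
  have h3 : minSpin a b * (minSpin a b + 1) = spin b * (spin b + 1) + spin a * (spin a + 1) -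
      2 * (spin a * (spin a + 1)) * κ := by
    exact_mod_cast mul_left_cancel₀ ha0 h1
  have h4 := amplificationFactor_mul (b := b) ha
  have h5 : κ = amplificationFactor (spin a) (spin b) := by
    refine mul_right_cancel₀ (spin_mul_pos ha).ne' ?_
    linarith
  rwa [← h5]

/-- A positive semidefinite summand of a multiple of a projection is supported on its range. -/
lemma mul_projection_eq_self {ι : Type*} [Fintype ι] [DecidableEq ι] {M N P : Matrix ι ι ℂ}
    (hM : M.PosSemidef) (hN : N.PosSemidef) {s t : ℝ} (hs : 0 < s) (ht : 0 < t) {c : ℂ}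
    (hP : P * P = P) (h : s • M + t • N = c • P) : M * P = M := by
  apply ext_of_mulVec_single
  intro i
  set v : ι → ℂ := Pi.single i 1
  have hu : P *ᵥ (v - P *ᵥ v) = 0 := by
    rw [mulVec_sub, mulVec_mulVec, hP, sub_self]
  set u := v - P *ᵥ v with hudef
  -- Since `P` kills `u`, the nonnegative forms of `M` and `N` at `u` have a vanishing positive
  -- combination.
  have h1 : s • (star u ⬝ᵥ (M *ᵥ u)) + t • (star u ⬝ᵥ (N *ᵥ u)) = 0 := by
    have h2 := congrArg (fun A => star u ⬝ᵥ (A *ᵥ u)) h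
    simpa only [add_mulVec, smul_mulVec, dotProduct_add, dotProduct_smul, hu, smul_zero,
      dotProduct_zero] using h2
  have hM0 := hM.dotProduct_mulVec_nonneg u
  have hN0 := hN.dotProduct_mulVec_nonneg u
  have h3 : star u ⬝ᵥ (M *ᵥ u) = 0 := by
    have h4 := (add_eq_zero_iff_of_nonneg (smul_nonneg hs.le hM0) (smul_nonneg ht.le hN0)).1 h1
    exact (smul_eq_zero.1 h4.1).resolve_left hs.ne'
  rw [hM.dotProduct_mulVec_zero_iff, hudef, mulVec_sub, sub_eq_zero, mulVec_mulVec] at h3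
  exact h3.symm

/-- The Choi matrix of a covariant summand is supported on the bottom subspace, so by irreducibility
it is a multiple of the projection; its trace fixes the multiple. -/
lemma extremalChannel_mem_extremePoints (a b : ℕ) :
    extremalChannel a b (minSpin a b) ∈ Set.extremePoints ℝ (covariantChannels a b) := by
  rw [mem_extremePoints_iff_left]
  refine ⟨extremalChannel_mem a b, ?_⟩
  rintro Φ ⟨hΦ, hΦc⟩ Ψ ⟨hΨ, -⟩ ⟨s, t, hs, ht, -, hst⟩
  apply choi_injective
  have h1 := congrArg choi hst
  rw [choi_add_smul, choi_extremalChannel] at h1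
  have h2 := mul_projection_eq_self (choi_posSemidef hΦ) (choi_posSemidef hΨ) hs ht
    (projection_mul_self a b _) h1
  obtain ⟨c, hc⟩ := eq_smul_projection_of_commute
    (fun k => intertwines_iff_commute.1 (hΦc.isInfinitesimallyCovariant k)) h2
  have h3 := trace_choi hΦ
  rw [hc, trace_smul, trace_projection, smul_eq_mul] at h3
  rw [choi_extremalChannel, hc, ← h3, mul_inv_cancel_right₀ (two_minSpin_ne_zero a b)]

end SpinChannel

theorem mainTheorem2 (a b : ℕ) (ha : 0 < a) (jA jB : ℝ)
    (hA : jA = SpinChannel.spin a) (hB : jB = SpinChannel.spin b) :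
    -- every covariant channel has a well-defined real polarisation scaling factor
    (∀ Φ ∈ SpinChannel.covariantChannels a b, ∃! κ : ℝ, SpinChannel.ScalesPolarisation Φ κ) ∧
    -- `ℰ^{(|jA - jB|)}` is an extremal covariant channel with scaling factor `κ₊`
    SpinChannel.extremalChannel a b |jA - jB| ∈
      Set.extremePoints ℝ (SpinChannel.covariantChannels a b) ∧
    SpinChannel.ScalesPolarisation (SpinChannel.extremalChannel a b |jA - jB|)
      (SpinChannel.amplificationFactor jA jB) ∧
    -- `κ₊` is the largest factor over the covariant channels
    IsGreatest {κ : ℝ | ∃ Φ ∈ SpinChannel.covariantChannels a b,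
      SpinChannel.ScalesPolarisation Φ κ} (SpinChannel.amplificationFactor jA jB) ∧
    -- and even over all channels that scale the polarisation isotropically
    IsGreatest {κ : ℝ | ∃ Φ : SpinChannel.Op a →ₗ[ℂ] SpinChannel.Op b,
      SpinChannel.IsChannel Φ ∧ SpinChannel.ScalesPolarisation Φ κ}
      (SpinChannel.amplificationFactor jA jB) := by
  subst hA hB
  have hscale := SpinChannel.extremalChannel_scalesPolarisation ha b
  have hmem := SpinChannel.extremalChannel_mem a b
  refine ⟨fun Φ hΦ => ?_, SpinChannel.extremalChannel_mem_extremePoints a b, hscale,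
    ⟨⟨_, hmem, hscale⟩, ?_⟩, ⟨⟨_, hmem.1, hscale⟩, ?_⟩⟩
  · obtain ⟨κ, hκ⟩ := SpinChannel.exists_scale ha hΦ.1 hΦ.2
    exact ⟨κ, hκ, fun κ' hκ' => SpinChannel.scalesPolarisation_unique ha hκ' hκ⟩
  · rintro κ ⟨Φ, hΦ, hκ⟩
    exact SpinChannel.scale_le_amplificationFactor ha hΦ.1 hκ
  · rintro κ ⟨Φ, hΦ, hκ⟩
    exact SpinChannel.scale_le_amplificationFactor ha hΦ hκ
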